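/- Let $\mathbb{B}=\{0,1\}^{\mathbb{Z}}$ be the set of two-color sceneries $\xi:\mathbb{Z}\to\{0,1\}$, equipped with the $\sigma$-algebra $\sigma(\mathbb{B})$ generated by the coordinates, and let $P$ be the probability measure on $(\mathbb{B},\sigma(\mathbb{B}))$ under which the $\xi(i)$, $i\in\mathbb{Z}$, are i.i.d. Bernoulli variables with parameter $\tfrac12$. Let $(S(k))_{k\ge 0}$ be a simple symmetric random walk on $\mathbb{Z}$ with $S(0)=0$. Call two sceneries $\xi,\eta\in\mathbb{B}$ distinguishable if there is a measurable set $A\subset\{0,1\}^{\mathbb{N}}$ (for the $\sigma$-algebra generated by the coordinates, $\mathbb N=\{0,1,2,\dots\}$) such that almost surely $(\xi(S(k)))_{k\ge 0}\in A$ and almost surely $(\eta(S(k)))_{k\ge 0}\notin A$; that is, a single observed color record almost surely tells which of the two sceneries generated it. Then there exists a set $\mathbb{S}\in\sigma(\mathbb{B})$ with $P(\mathbb{S})=1$ such that for every $\xi\in\mathbb{S}$ and every scenery $\eta$ that is equal to $\xi$ everywhere except in exactly one point, $\xi$ and $\eta$ are distinguishable. -/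

import Mathlib

open MeasureTheory ProbabilityTheory

namespace SceneryReconstruction

/-- A two-color scenery. -/
abbrev Scenery : Type := ℤ → Fin 2

/-- The parameter `1/2`, as an element of the unit interval. -/
noncomputable def oneHalf : unitInterval := ⟨1 / 2, by norm_num, by norm_num⟩

/-- The law on sceneries under which the colors are i.i.d. Bernoulli with parameter `1/2`;
the sigma-algebra on `Scenery` is the product one, generated by the coordinates. -/
noncomputable def sceneryMeasure : Measure Scenery :=
  Measure.infinitePi fun _ : ℤ => bernoulliMeasure (1 : Fin 2) 0 oneHalf

/-- The law of an i.i.d. sequence of steps, each equal to `1` or `-1` with probability `1/2`. -/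
noncomputable def stepMeasure : Measure (ℕ → ℤ) :=
  Measure.infinitePi fun _ : ℕ => bernoulliMeasure (1 : ℤ) (-1) oneHalf

/-- The path with the given steps that starts at the origin. -/
def walk (steps : ℕ → ℤ) (k : ℕ) : ℤ := ∑ i ∈ Finset.range k, steps i

/-- The law of the simple random walk on `ℤ` started at the origin. -/
noncomputable def simpleRandomWalk : Measure (ℕ → ℤ) := stepMeasure.map walk

/-- The color record `k ↦ ξ (S k)` of the scenery `ξ` along the path `S`. -/
def colorRecord (ξ : Scenery) (S : ℕ → ℤ) : ℕ → Fin 2 := fun k => ξ (S k)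

/-- Two (known) sceneries are distinguishable if a measurable test applied to a single color
record decides almost surely which of them generated it: the test answers `ξ` when the record
lies in `A` and `η` otherwise, and it is almost surely right in both cases. -/
def Distinguishable (ξ η : Scenery) : Prop :=
  ∃ A : Set (ℕ → Fin 2), MeasurableSet A ∧
    (∀ᵐ S ∂simpleRandomWalk, colorRecord ξ S ∈ A) ∧
    (∀ᵐ S ∂simpleRandomWalk, colorRecord η S ∉ A)

/-- `η` agrees with `ξ` everywhere except in exactly one point. -/
def DifferInOnePoint (ξ η : Scenery) : Prop := ∃! x : ℤ, η x ≠ ξ x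

theorem measurable_walk : Measurable walk :=
  measurable_pi_lambda _ fun k =>
    Finset.measurable_sum (Finset.range k) fun i _ => measurable_pi_apply i

instance : IsProbabilityMeasure sceneryMeasure := by
  unfold sceneryMeasure; infer_instance

instance : IsProbabilityMeasure stepMeasure := by
  unfold stepMeasure; infer_instance

instance : IsProbabilityMeasure simpleRandomWalk :=
  Measure.isProbabilityMeasure_map measurable_walk.aemeasurable

end SceneryReconstruction

/-!
A color record shows, at every step, whether the two end points of the crossed edge have the same
color. Turned at odd sites, these bits form an environment of fair coins on the edges of `ℤ`, and a
record of `ξ` that could also come from `η` yields a *follower*: a second nearest-neighbor path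
that reads off the environment of `η` the symbols the walker reads off that of `ξ`. The test answers
`ξ` when the record is impossible for `η`, and what must be shown is that almost surely no follower
survives.

The environment is the gradient of a simple random walk `V` indexed by `ℤ`, and walker and follower
always agree on the increments of `V` along their paths. Followers far away see an independent
environment: whenever the walker leaves the valley where `|V| < j` through a wall that keeps rising,
while the walls the follower can be at turn back, the follower dies. This has a chance bounded from
below at each level `j`, so at most sites all far followers die soon. Near followers have to be
killed by the few edges where the two environments differ. The walker goes straight from one rare
pattern, a beacon, across these edges to another; the beacons pin a near follower to the walker at
both ends, and it then reads a wrong symbol in between. Followers at intermediate distance die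
because a path and its follower can be reversed in time. So all followers die with positive
probability, and by recurrence almost surely.
-/

open scoped ENNReal

namespace SceneryReconstruction

/-! ### Events that depend on few coordinates -/

section Coordinates

variable {ι : Type*} {X : ι → Type*}

theorem dependsOn_mem_of_imp {I : Set ι} {B : Set (∀ i, X i)}
    (h : ∀ ω ω' : ∀ i, X i, (∀ i ∈ I, ω i = ω' i) → ω ∈ B → ω' ∈ B) :
    DependsOn (fun ω => ω ∈ B) I := fun ω ω' hω =>
  propext ⟨h ω ω' hω, h ω' ω fun i hi => (hω i hi).symm⟩

theorem mem_of_dependsOn {I : Set ι} {B : Set (∀ i, X i)} (hB : DependsOn (fun ω => ω ∈ B) I)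
    {ω ω' : ∀ i, X i} (h : ∀ i ∈ I, ω i = ω' i) (hω : ω ∈ B) : ω' ∈ B :=
  (hB h).mp hω

theorem exists_eq_preimage_domRestrict {I : Set ι} {B : Set (∀ i, X i)}
    (hB : DependsOn (fun ω => ω ∈ B) I) : ∃ R, B = I.domRestrict ⁻¹' R := by
  obtain ⟨g, hg⟩ := dependsOn_iff_exists_comp.1 hB
  exact ⟨{x | g x}, Set.ext fun ω => (congrFun hg ω).to_iff⟩

variable [∀ i, MeasurableSpace (X i)]

theorem measurableSet_of_dependsOn_finite [∀ i, Countable (X i)]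
    [∀ i, MeasurableSingletonClass (X i)] {I : Set ι} (hI : I.Finite) {B : Set (∀ i, X i)}
    (hB : DependsOn (fun ω => ω ∈ B) I) : MeasurableSet B := by
  have : Finite I := hI
  obtain ⟨R, rfl⟩ := exists_eq_preimage_domRestrict hB
  exact (measurable_pi_lambda _ fun i => measurable_pi_apply _) R.to_countable.measurableSet

theorem measurableSet_iSup_comap_eval_of_dependsOn {I : Set ι} {B : Set (∀ i, X i)}
    (hm : MeasurableSet B) (hB : DependsOn (fun ω => ω ∈ B) I) :
    MeasurableSet[⨆ i ∈ I, MeasurableSpace.comap (Function.eval i) inferInstance] B := by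
  classical
  rcases B.eq_empty_or_nonempty with rfl | ⟨ω₀, -⟩
  · exact @MeasurableSet.empty _ (_)
  have hpre : (fun ω i => if i ∈ I then ω i else ω₀ i) ⁻¹' B = B := by
    ext ω
    exact (hB fun i hi => if_pos hi).to_iff
  have hg : Measurable[⨆ i ∈ I, MeasurableSpace.comap (Function.eval i) inferInstance]
      (fun (ω : ∀ i, X i) i => if i ∈ I then ω i else ω₀ i) := by
    refine @measurable_pi_lambda _ _ _ (_) _ _ fun i => ?_
    by_cases hi : i ∈ I
    · simpa only [hi, if_true] using
        (comap_measurable (Function.eval i)).mono (le_iSup₂_of_le i hi le_rfl) le_rfl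
    · simpa only [hi, if_false] using @measurable_const _ _ _ (_) _
  rw [← hpre]
  exact hg hm

theorem infinitePi_inter_of_dependsOn {μ : ∀ i, Measure (X i)} [∀ i, IsProbabilityMeasure (μ i)]
    {I J : Set ι} (hIJ : Disjoint I J) {B C : Set (∀ i, X i)} (hBm : MeasurableSet B)
    (hCm : MeasurableSet C) (hB : DependsOn (fun ω => ω ∈ B) I)
    (hC : DependsOn (fun ω => ω ∈ C) J) :
    Measure.infinitePi μ (B ∩ C) = Measure.infinitePi μ B * Measure.infinitePi μ C := by
  have hindep : iIndep (fun i => MeasurableSpace.comap (Function.eval i) inferInstance)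
      (Measure.infinitePi μ) :=
    iIndepFun_infinitePi (P := μ) (X := fun _ x => x) fun _ => measurable_id
  exact Indep_iff _ _ _ |>.mp
    (indep_iSup_of_disjoint (fun i => (measurable_pi_apply i).comap_le) hindep hIJ) B C
    (measurableSet_iSup_comap_eval_of_dependsOn hBm hB)
    (measurableSet_iSup_comap_eval_of_dependsOn hCm hC)

end Coordinates

/-! ### Families of fair coins -/

/-- The law of a family of independent fair coins. -/
noncomputable def fairCoins (κ : Type*) : Measure (κ → Bool) :=
  Measure.infinitePi fun _ => bernoulliMeasure true false oneHalf

instance (κ : Type*) : IsProbabilityMeasure (fairCoins κ) := by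
  unfold fairCoins; infer_instance

theorem bernoulliMeasure_oneHalf_map {X Y : Type*} [MeasurableSpace X] [MeasurableSpace Y]
    (x y : X) {f : X → Y} (hf : Measurable f) :
    (bernoulliMeasure x y oneHalf).map f = bernoulliMeasure (f x) (f y) oneHalf := by
  simp only [bernoulliMeasure_def]
  rw [Measure.map_add _ _ hf, Measure.map_smul, Measure.map_smul, Measure.map_dirac' hf,
    Measure.map_dirac' hf]

theorem bernoulliMeasure_oneHalf_comm {X : Type*} [MeasurableSpace X] (x y : X) :
    bernoulliMeasure x y oneHalf = bernoulliMeasure y x oneHalf := by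
  have hsymm : unitInterval.symm oneHalf = oneHalf := by
    ext; simp [oneHalf]; norm_num
  simp only [bernoulliMeasure_def, hsymm]
  rw [add_comm]

theorem bernoulliMeasure_oneHalf_singleton (b : Bool) :
    bernoulliMeasure true false oneHalf {b} = 2⁻¹ := by
  classical
  have hhalf : (unitInterval.toNNReal oneHalf : ℝ≥0∞) = 2⁻¹ := by
    rw [show unitInterval.toNNReal oneHalf = 2⁻¹ by ext; simp [oneHalf]]
    simp
  cases b
  · rw [bernoulliMeasure_oneHalf_comm, bernoulliMeasure_apply _ (measurableSet_singleton _)]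
    simp [hhalf]
  · rw [bernoulliMeasure_apply _ (measurableSet_singleton _)]
    simp [hhalf]

theorem measurable_comp_xor {κ κ' : Type*} (j : κ' → κ) (g : κ' → Bool) :
    Measurable fun (ω : κ → Bool) i => xor (ω (j i)) (g i) :=
  measurable_pi_lambda _ fun i =>
    (measurable_of_finite fun c => xor c (g i)).comp (measurable_pi_apply (j i))

theorem fairCoins_map_comp_xor {κ κ' : Type*} {j : κ' → κ} (hj : Function.Injective j)
    (g : κ' → Bool) :
    (fairCoins κ).map (fun ω i => xor (ω (j i)) (g i)) = fairCoins κ' := by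
  have hflip (b : Bool) : (bernoulliMeasure true false oneHalf).map (fun c => xor c b)
      = bernoulliMeasure true false oneHalf := by
    rw [bernoulliMeasure_oneHalf_map _ _ (measurable_of_finite _)]
    cases b
    · simp
    · simpa using bernoulliMeasure_oneHalf_comm _ _
  have hsel := Measure.map_infinitePi_infinitePi_of_inj
    (P := fun _ : κ => bernoulliMeasure true false oneHalf) hj
  have hxor := Measure.infinitePi_map_pi (μ := fun _ : κ' => bernoulliMeasure true false oneHalf)
    (f := fun i b => xor b (g i)) fun _ => measurable_of_finite _
  simp only [hflip] at hxor
  rw [fairCoins, fairCoins, ← hxor, ← hsel, Measure.map_map _ (by fun_prop)]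
  · rfl
  · exact measurable_comp_xor id g

section Cylinders

variable {κ : Type*}

theorem measurableSet_coin_eq (i : κ) (b : Bool) : MeasurableSet {ω : κ → Bool | ω i = b} :=
  measurableSet_eq_fun (measurable_pi_apply i) measurable_const

theorem fairCoins_cylinder (I : Finset κ) (v : κ → Bool) :
    fairCoins κ {ω | ∀ i ∈ I, ω i = v i} = 2⁻¹ ^ I.card := by
  have h := Measure.infinitePi_pi (fun _ : κ => bernoulliMeasure true false oneHalf)
    (s := I) (t := fun i => {v i}) fun _ _ => measurableSet_singleton _
  simp only [bernoulliMeasure_oneHalf_singleton, Finset.prod_const] at h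
  exact h

theorem dependsOn_cylinder (I : Finset κ) (v : κ → Bool) :
    DependsOn (fun ω => ω ∈ {ω : κ → Bool | ∀ i ∈ I, ω i = v i}) (I : Set κ) :=
  dependsOn_mem_of_imp fun _ _ h hω i hi => (h i hi).symm.trans (hω i hi)

theorem measurableSet_cylinder_eq (I : Finset κ) (v : κ → Bool) :
    MeasurableSet {ω : κ → Bool | ∀ i ∈ I, ω i = v i} :=
  measurableSet_of_dependsOn_finite I.finite_toSet (dependsOn_cylinder I v)

theorem fairCoins_cylinder_inter {I : Finset κ} (v : κ → Bool) {C : Set (κ → Bool)}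
    (hCm : MeasurableSet C) (hC : DependsOn (fun ω => ω ∈ C) (I : Set κ)ᶜ) :
    fairCoins κ ({ω | ∀ i ∈ I, ω i = v i} ∩ C) = 2⁻¹ ^ I.card * fairCoins κ C := by
  rw [← fairCoins_cylinder I v]
  exact infinitePi_inter_of_dependsOn disjoint_compl_right (measurableSet_cylinder_eq I v) hCm
    (dependsOn_cylinder I v) hC

theorem fairCoins_iUnion_cylinder_inter {α : Type*} [Countable α] {C : α → Set (κ → Bool)}
    (hdisj : Pairwise (Function.onFun Disjoint C)) (hCm : ∀ p, MeasurableSet (C p))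
    {I : α → Finset κ} {m : ℕ} (hcard : ∀ p, (I p).card = m)
    (hC : ∀ p, DependsOn (fun ω => ω ∈ C p) (I p : Set κ)ᶜ) (v : α → κ → Bool) :
    fairCoins κ (⋃ p, {ω | ∀ i ∈ I p, ω i = v p i} ∩ C p) = 2⁻¹ ^ m * fairCoins κ (⋃ p, C p) := by
  rw [measure_iUnion hdisj hCm, ← ENNReal.tsum_mul_left, measure_iUnion
    (fun p p' hne => (hdisj hne).mono Set.inter_subset_right Set.inter_subset_right)
    fun p => (measurableSet_cylinder_eq (I p) (v p)).inter (hCm p)]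
  exact tsum_congr fun p => by rw [fairCoins_cylinder_inter (v p) (hCm p) (hC p), hcard]

theorem eq_fairCoins_of_cylinder {μ : Measure (κ → Bool)}
    (h : ∀ (I : Finset κ) (v : κ → Bool), μ {ω | ∀ i ∈ I, ω i = v i} = 2⁻¹ ^ I.card) :
    μ = fairCoins κ := by
  classical
  refine ((Measure.isProjectiveLimit_infinitePi _).unique fun I => ?_).symm
  refine Measure.ext_of_singleton fun y => ?_
  have hpre : (I.restrict : (κ → Bool) → I → Bool) ⁻¹' {y}
      = {ω | ∀ i ∈ I, ω i = if hi : i ∈ I then y ⟨i, hi⟩ else true} := by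
    ext ω
    simp +contextual [funext_iff]
  rw [Measure.map_apply (Finset.measurable_restrict I) (measurableSet_singleton y), hpre, h,
    Measure.pi_singleton]
  simp [bernoulliMeasure_oneHalf_singleton]

theorem measure_cylinder_of_map_update_not [DecidableEq κ] {μ : Measure (κ → Bool)}
    [IsProbabilityMeasure μ] (h : ∀ i, μ.map (fun ω => Function.update ω i (!ω i)) = μ)
    (I : Finset κ) (v : κ → Bool) : μ {ω | ∀ i ∈ I, ω i = v i} = 2⁻¹ ^ I.card := by
  induction I using Finset.induction_on with
  | empty => simp
  | insert i s hi ih =>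
    set S := {ω : κ → Bool | ∀ j ∈ s, ω j = v j} with hS
    have hflip : Measurable fun ω : κ → Bool => Function.update ω i (!ω i) := by fun_prop
    have heq : μ (S \ {ω | ω i = v i}) = μ (S ∩ {ω | ω i = v i}) := by
      conv_rhs => rw [← h i]
      rw [Measure.map_apply hflip
        ((measurableSet_cylinder_eq s v).inter (measurableSet_coin_eq i (v i)))]
      congr 1
      ext ω
      have hS' : Function.update ω i (!ω i) ∈ S ↔ ω ∈ S := forall₂_congr fun j hj => by
        rw [Function.update_of_ne (ne_of_mem_of_not_mem hj hi)]
      rw [Set.mem_sdiff, Set.mem_preimage, Set.mem_inter_iff, hS']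
      cases hω : ω i <;> cases hv : v i <;> simp [hω]
    have hsum := measure_inter_add_sdiff (μ := μ) S (measurableSet_coin_eq i (v i))
    have hinsert : {ω : κ → Bool | ∀ j ∈ insert i s, ω j = v j} = S ∩ {ω | ω i = v i} := by
      ext ω; simp [hS, and_comm]
    rw [heq, ← two_mul, ih] at hsum
    rw [hinsert, Finset.card_insert_of_notMem hi, pow_succ', ← hsum, ← mul_assoc,
      ENNReal.inv_mul_cancel (by simp) (by simp), one_mul]

theorem eq_fairCoins_of_map_update_not [DecidableEq κ] {μ : Measure (κ → Bool)}
    [IsProbabilityMeasure μ] (h : ∀ i, μ.map (fun ω => Function.update ω i (!ω i)) = μ) :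
    μ = fairCoins κ :=
  eq_fairCoins_of_cylinder (measure_cylinder_of_map_update_not h)

end Cylinders

theorem fairCoins_prod_map_sumElim (α β : Type*) :
    ((fairCoins α).prod (fairCoins β)).map (fun p => Sum.elim p.1 p.2) = fairCoins (α ⊕ β) := by
  have hm : Measurable fun p : (α → Bool) × (β → Bool) => (Sum.elim p.1 p.2 : α ⊕ β → Bool) :=
    measurable_pi_lambda _ (Sum.rec (fun a => (measurable_pi_apply a).comp measurable_fst)
      fun b => (measurable_pi_apply b).comp measurable_snd)
  refine eq_fairCoins_of_cylinder fun I v => ?_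
  have hpre : (fun p : (α → Bool) × (β → Bool) => (Sum.elim p.1 p.2 : α ⊕ β → Bool)) ⁻¹'
      {ω | ∀ i ∈ I, ω i = v i}
      = {ω | ∀ a ∈ I.toLeft, ω a = v (Sum.inl a)} ×ˢ
        {ω | ∀ b ∈ I.toRight, ω b = v (Sum.inr b)} := by
    ext p
    simp [Sum.forall]
  rw [Measure.map_apply hm (measurableSet_cylinder_eq I v), hpre, Measure.prod_prod,
    fairCoins_cylinder _ fun a => v (Sum.inl a), fairCoins_cylinder _ fun b => v (Sum.inr b),
    ← pow_add, Finset.card_toLeft_add_card_toRight]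

/-! ### The simple random walk driven by fair coins -/

/-- The displacement that belongs to a coin. -/
def step (b : Bool) : ℤ := if b then 1 else -1

/-- The nearest-neighbor path that starts at `z` and moves according to the coins `s`. -/
def path (z : ℤ) (s : ℕ → Bool) (n : ℕ) : ℤ := z + walk (fun i => step (s i)) n

/-- Forget the first `n` coins. -/
def shift (n : ℕ) (s : ℕ → Bool) : ℕ → Bool := fun i => s (n + i)

@[simp] theorem step_true : step true = 1 := rfl
@[simp] theorem step_false : step false = -1 := rfl

theorem step_eq_or (b : Bool) : step b = 1 ∨ step b = -1 := by cases b <;> simp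

@[simp] theorem path_zero (z : ℤ) (s : ℕ → Bool) : path z s 0 = z := by simp [path, walk]

theorem path_succ (z : ℤ) (s : ℕ → Bool) (i : ℕ) : path z s (i + 1) = path z s i + step (s i) := by
  rw [path, path, walk, walk, Finset.sum_range_succ, add_assoc]

theorem path_add (z : ℤ) (s : ℕ → Bool) (n m : ℕ) :
    path z s (n + m) = path (path z s n) (shift n s) m := by
  simp only [path, walk, shift, Finset.sum_range_add, add_assoc]

theorem path_succ' (z : ℤ) (s : ℕ → Bool) (i : ℕ) :
    path z s (i + 1) = path (z + step (s 0)) (shift 1 s) i := by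
  rw [add_comm, path_add, path_succ z s 0, path_zero]

theorem path_congr (z : ℤ) {s s' : ℕ → Bool} {n : ℕ} (h : ∀ i < n, s i = s' i) :
    path z s n = path z s' n := by
  rw [path, path, walk, walk, Finset.sum_congr rfl fun i hi => by rw [h i (Finset.mem_range.1 hi)]]

theorem path_eq_add (z : ℤ) (s : ℕ → Bool) (n : ℕ) : path z s n = z + path 0 s n := by
  rw [path, path, zero_add]

theorem abs_path_sub_le (z : ℤ) (s : ℕ → Bool) (n : ℕ) : |path z s n - z| ≤ n := by
  induction n with
  | zero => simp
  | succ n ih =>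
    rw [path_succ]
    rw [abs_le] at ih ⊢
    rcases step_eq_or (s n) with h | h <;> rw [h] <;> push_cast <;> constructor <;> linarith

theorem measurable_path (z : ℤ) (n : ℕ) : Measurable fun s : ℕ → Bool => path z s n :=
  measurable_const.add (Finset.measurable_sum _ fun i _ =>
    (measurable_of_finite step).comp (measurable_pi_apply i))

theorem measurable_shift (n : ℕ) : Measurable (shift n) :=
  measurable_pi_lambda _ fun i => measurable_pi_apply (n + i)

theorem fairCoins_map_shift (n : ℕ) : (fairCoins ℕ).map (shift n) = fairCoins ℕ := by
  have h := fairCoins_map_comp_xor (add_right_injective n) fun _ : ℕ => false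
  simp only [Bool.xor_false] at h
  exact h

theorem fairCoins_preimage_shift (n : ℕ) {C : Set (ℕ → Bool)} (hC : MeasurableSet C) :
    fairCoins ℕ (shift n ⁻¹' C) = fairCoins ℕ C := by
  rw [← Measure.map_apply (measurable_shift n) hC, fairCoins_map_shift]

theorem fairCoins_inter_preimage_shift {n : ℕ} {B C : Set (ℕ → Bool)}
    (hB : DependsOn (fun s => s ∈ B) (Set.Iio n)) (hC : MeasurableSet C) :
    fairCoins ℕ (B ∩ shift n ⁻¹' C) = fairCoins ℕ B * fairCoins ℕ C := by
  have hshift : DependsOn (fun s => s ∈ shift n ⁻¹' C) (Set.Ici n) := fun s s' h => by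
    have : shift n s = shift n s' := funext fun i => h (n + i) (Nat.le_add_right n i)
    simp only [Set.mem_preimage, this]
  rw [← fairCoins_preimage_shift n hC]
  exact infinitePi_inter_of_dependsOn (Set.Iio_disjoint_Ici le_rfl)
    (measurableSet_of_dependsOn_finite (Set.finite_Iio n) hB) (measurable_shift n hC) hB hshift

theorem fairCoins_iUnion_inter_preimage_shift {B : ℕ → Set (ℕ → Bool)} {C : Set (ℕ → Bool)}
    (hdisj : Pairwise (Function.onFun Disjoint B))
    (hB : ∀ n, DependsOn (fun s => s ∈ B n) (Set.Iio n)) (hC : MeasurableSet C) :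
    fairCoins ℕ (⋃ n, B n ∩ shift n ⁻¹' C) = fairCoins ℕ (⋃ n, B n) * fairCoins ℕ C := by
  have hBm n : MeasurableSet (B n) := measurableSet_of_dependsOn_finite (Set.finite_Iio n) (hB n)
  rw [measure_iUnion (fun _ _ h => (hdisj h).mono Set.inter_subset_left Set.inter_subset_left)
      fun n => (hBm n).inter (measurable_shift n hC), measure_iUnion hdisj hBm,
    ← ENNReal.tsum_mul_right]
  exact tsum_congr fun n => fairCoins_inter_preimage_shift (hB n) hC

theorem fairCoins_le_mul_of_restart {A P K : Set (ℕ → Bool)} {T : ℕ → Set (ℕ → Bool)} {n : ℕ}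
    (hA : DependsOn (fun s => s ∈ A) (Set.Iio n))
    (hT : ∀ n, DependsOn (fun s => s ∈ T n) (Set.Iio n))
    (hrec : ∀ᵐ s ∂fairCoins ℕ, ∃ᶠ n in Filter.atTop, s ∈ T n) (hK : MeasurableSet K)
    (hPA : P ⊆ A) (hrestart : ∀ s ∈ P, ∀ n, s ∈ T n → shift n s ∈ K) :
    fairCoins ℕ P ≤ fairCoins ℕ A * fairCoins ℕ K := by
  let B (k : ℕ) := {s | n ≤ k ∧ s ∈ A ∧ s ∈ T k ∧ ∀ j < k, n ≤ j → s ∉ T j}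
  have hdisj : Pairwise (Function.onFun Disjoint B) := fun k l hkl =>
    Set.disjoint_left.2 fun s hk hl => hkl (le_antisymm
      (not_lt.1 fun h => hk.2.2.2 l h hl.1 hl.2.2.1)
      (not_lt.1 fun h => hl.2.2.2 k h hk.1 hk.2.2.1))
  have hB k : DependsOn (fun s => s ∈ B k) (Set.Iio k) := by
    refine dependsOn_mem_of_imp fun s s' h ⟨hnk, hsA, hsT, hmin⟩ => ⟨hnk, ?_, ?_, ?_⟩
    · exact mem_of_dependsOn hA (fun i hi => h i (hi.trans_le hnk)) hsA
    · exact mem_of_dependsOn (hT k) h hsT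
    · exact fun j hj hnj hj' => hmin j hj hnj
        (mem_of_dependsOn (hT j) (fun i hi => (h i (lt_trans hi hj)).symm) hj')
  have hcover : ∀ᵐ s ∂fairCoins ℕ, s ∈ P → s ∈ ⋃ k, B k ∩ shift k ⁻¹' K := by
    classical
    filter_upwards [hrec] with s hs hsP
    have hex := Filter.frequently_atTop.1 hs n
    obtain ⟨hn, hsT⟩ := Nat.find_spec hex
    exact Set.mem_iUnion.2 ⟨Nat.find hex, ⟨hn, hPA hsP, hsT,
      fun j hj hnj hj' => Nat.find_min hex hj ⟨hnj, hj'⟩⟩, hrestart s hsP _ hsT⟩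
  calc fairCoins ℕ P ≤ fairCoins ℕ (⋃ k, B k ∩ shift k ⁻¹' K) := measure_mono_ae hcover
    _ = fairCoins ℕ (⋃ k, B k) * fairCoins ℕ K :=
        fairCoins_iUnion_inter_preimage_shift hdisj hB hK
    _ ≤ fairCoins ℕ A * fairCoins ℕ K := by
        gcongr
        exact Set.iUnion_subset fun k s hs => hs.2.1

theorem fairCoins_iInter_eq_zero_of_restart {A T : ℕ → Set (ℕ → Bool)} {K : Set (ℕ → Bool)}
    (hA : ∀ n, DependsOn (fun s => s ∈ A n) (Set.Iio n)) (hanti : Antitone A)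
    (hT : ∀ n, DependsOn (fun s => s ∈ T n) (Set.Iio n))
    (hrec : ∀ᵐ s ∂fairCoins ℕ, ∃ᶠ n in Filter.atTop, s ∈ T n) (hKm : MeasurableSet K)
    (hK : fairCoins ℕ K < 1)
    (hrestart : ∀ s ∈ ⋂ n, A n, ∀ n, s ∈ T n → shift n s ∈ K) :
    fairCoins ℕ (⋂ n, A n) = 0 := by
  have hlim := ENNReal.Tendsto.mul_const (b := fairCoins ℕ K) (tendsto_measure_iInter_atTop
    (μ := fairCoins ℕ)
    (fun n => (measurableSet_of_dependsOn_finite (Set.finite_Iio n) (hA n)).nullMeasurableSet)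
    hanti ⟨0, by finiteness⟩) (Or.inr (by finiteness))
  have hle : fairCoins ℕ (⋂ n, A n) ≤ fairCoins ℕ (⋂ n, A n) * fairCoins ℕ K :=
    ge_of_tendsto' hlim fun n =>
      fairCoins_le_mul_of_restart (hA n) hT hrec hKm (Set.iInter_subset A n) hrestart
  by_contra hne
  refine hle.not_gt ?_
  simpa only [mul_one] using ENNReal.mul_lt_mul_right hne (by finiteness) hK

theorem fairCoins_real_first_step {E : Bool → Set (ℕ → Bool)} (hE : ∀ b, MeasurableSet (E b)) :
    (fairCoins ℕ).real {s | shift 1 s ∈ E (s 0)}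
      = ((fairCoins ℕ).real (E true) + (fairCoins ℕ).real (E false)) / 2 := by
  have hhalf b : fairCoins ℕ ({s | ∀ i ∈ ({0} : Finset ℕ), s i = b} ∩ shift 1 ⁻¹' E b)
      = 2⁻¹ * fairCoins ℕ (E b) := by
    rw [fairCoins_inter_preimage_shift ((dependsOn_cylinder {0} fun _ => b).mono (by simp)) (hE b),
      fairCoins_cylinder {0} fun _ => b, Finset.card_singleton, pow_one]
  have hsplit : {s | shift 1 s ∈ E (s 0)}
      = ({s | ∀ i ∈ ({0} : Finset ℕ), s i = true} ∩ shift 1 ⁻¹' E true)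
        ∪ ({s | ∀ i ∈ ({0} : Finset ℕ), s i = false} ∩ shift 1 ⁻¹' E false) := by
    ext s
    cases h : s 0 <;> simp [h]
  rw [hsplit, measureReal_union]
  · simp only [measureReal_def, hhalf, ENNReal.toReal_mul, ENNReal.toReal_inv,
      ENNReal.toReal_ofNat]
    ring
  · refine Set.disjoint_left.2 fun s ht hf => ?_
    simp_all
  · exact (measurableSet_cylinder_eq _ _).inter (measurable_shift 1 (hE false))

/-! ### Recurrence -/

theorem eq_one_of_harmonic_nat {a : ℕ → ℝ} (h0 : a 0 = 1) (hle : ∀ k, a k ≤ 1)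
    (hge : ∀ k, 0 ≤ a k) (h : ∀ k, a (k + 1) = (a k + a (k + 2)) / 2) (k : ℕ) : a k = 1 := by
  have hlinear (k : ℕ) : a k = 1 + k * (a 1 - 1) ∧ a (k + 1) = 1 + (k + 1) * (a 1 - 1) := by
    induction k with
    | zero => simp [h0]
    | succ k ih =>
      refine ⟨by push_cast; exact ih.2, ?_⟩
      push_cast
      linarith [h k, ih.1, ih.2]
  have h1 : a 1 = 1 := by
    by_contra hne
    have hlt : a 1 < 1 := lt_of_le_of_ne (hle 1) hne
    obtain ⟨n, hn⟩ := exists_nat_gt (1 / (1 - a 1))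
    rw [div_lt_iff₀ (by linarith)] at hn
    linarith [hge n, (hlinear n).1]
  rw [(hlinear k).1, h1]; ring

theorem eq_one_of_harmonic_off_zero {f : ℤ → ℝ} (h0 : f 0 = 1) (hle : ∀ y, f y ≤ 1)
    (hge : ∀ y, 0 ≤ f y) (h : ∀ y ≠ 0, f y = (f (y + 1) + f (y - 1)) / 2) (y : ℤ) : f y = 1 := by
  obtain ⟨k, rfl | rfl⟩ := y.eq_nat_or_neg
  · refine eq_one_of_harmonic_nat (a := fun k => f k) h0 (fun _ => hle _) (fun _ => hge _)
      (fun k => ?_) k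
    rw [h _ (by omega), add_comm]
    congr 3
    push_cast
    ring
  · refine eq_one_of_harmonic_nat (a := fun k => f (-k)) (by simpa using h0) (fun _ => hle _)
      (fun _ => hge _) (fun k => ?_) k
    rw [h _ (by omega)]
    congr 3
    push_cast
    ring

theorem measurableSet_exists_path_eq (y z : ℤ) :
    MeasurableSet {s : ℕ → Bool | ∃ n, path y s n = z} := by
  simp only [Set.ofPred_exists]
  exact MeasurableSet.iUnion fun n => measurableSet_eq_fun (measurable_path y n) measurable_const

theorem ae_exists_path_eq (y z : ℤ) : ∀ᵐ s ∂fairCoins ℕ, ∃ n, path y s n = z := by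
  let f (x : ℤ) := (fairCoins ℕ).real {s : ℕ → Bool | ∃ n, path (z + x) s n = z}
  have h0 : f 0 = 1 := by
    have hall : {s : ℕ → Bool | ∃ n, path (z + 0) s n = z} = Set.univ := by
      ext s
      simp only [add_zero, Set.mem_ofPred_eq, Set.mem_univ, iff_true]
      exact ⟨0, path_zero z s⟩
    simp only [f, hall, probReal_univ]
  have hharmonic x (hx : x ≠ 0) : f x = (f (x + 1) + f (x - 1)) / 2 := by
    have hfirst := fairCoins_real_first_step
      (fun b => measurableSet_exists_path_eq (z + x + step b) z)
    simp only [f, ← add_assoc, ← add_sub_assoc]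
    rw [step_true, step_false, ← sub_eq_add_neg] at hfirst
    rw [← hfirst]
    congr 1
    ext s
    constructor
    · rintro ⟨n, hn⟩
      cases n with
      | zero => exact absurd (by simpa using hn) hx
      | succ n => exact ⟨n, by rw [← path_succ', hn]⟩
    · exact fun ⟨n, hn⟩ => ⟨n + 1, by rw [path_succ', hn]⟩
  have hf := eq_one_of_harmonic_off_zero h0 (fun _ => measureReal_le_one)
    (fun _ => measureReal_nonneg) hharmonic (y - z)
  simp only [f, add_sub_cancel] at hf
  rw [ae_iff_measure_eq (measurableSet_exists_path_eq y z).nullMeasurableSet, measure_univ]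
  exact (ENNReal.toReal_eq_one_iff _).1 hf

theorem ae_frequently_path_eq (y z : ℤ) :
    ∀ᵐ s ∂fairCoins ℕ, ∃ᶠ n in Filter.atTop, path y s n = z := by
  have hrestart (n : ℕ) (w : ℤ) : ∀ᵐ s ∂fairCoins ℕ, ∃ m, path w (shift n s) m = z := by
    have := ae_exists_path_eq w z
    rw [← fairCoins_map_shift n] at this
    exact ae_of_ae_map (measurable_shift n).aemeasurable this
  filter_upwards [ae_all_iff.2 fun n => ae_all_iff.2 (hrestart n)] with s hs
  refine Filter.frequently_atTop.2 fun n => ?_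
  obtain ⟨m, hm⟩ := hs n (path y s n)
  exact ⟨n + m, Nat.le_add_right n m, by rw [path_add, hm]⟩

/-! ### Confinement to an interval -/

theorem measurableSet_confined (a z : ℤ) (m : ℕ) :
    MeasurableSet {s : ℕ → Bool | ∀ k ≤ m, |path z s k| < a} := by
  simp only [Set.ofPred_forall]
  exact MeasurableSet.iInter fun k => MeasurableSet.iInter fun _ =>
    measurable_path z k (MeasurableSet.of_discrete (s := {w : ℤ | |w| < a}))

theorem fairCoins_real_confined_succ {a z : ℤ} (hz : |z| < a) (m : ℕ) :
    (fairCoins ℕ).real {s | ∀ k ≤ m + 1, |path z s k| < a}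
      = ((fairCoins ℕ).real {s | ∀ k ≤ m, |path (z + 1) s k| < a}
        + (fairCoins ℕ).real {s | ∀ k ≤ m, |path (z - 1) s k| < a}) / 2 := by
  have hfirst := fairCoins_real_first_step fun b => measurableSet_confined a (z + step b) m
  rw [step_true, step_false, ← sub_eq_add_neg] at hfirst
  rw [← hfirst]
  congr 1
  ext s
  simp only [Set.mem_ofPred_eq]
  refine ⟨fun h k hk => path_succ' z s k ▸ h (k + 1) (by omega), fun h k hk => ?_⟩
  cases k with
  | zero => simpa using hz
  | succ k => exact path_succ' z s k ▸ h k (by omega)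

theorem fairCoins_real_confined_eq_zero {a z : ℤ} (hz : a ≤ |z|) (m : ℕ) :
    (fairCoins ℕ).real {s | ∀ k ≤ m, |path z s k| < a} = 0 := by
  have hempty : {s : ℕ → Bool | ∀ k ≤ m, |path z s k| < a} = ∅ := by
    ext s
    simp only [Set.mem_ofPred_eq, Set.mem_empty_iff_false, iff_false]
    exact fun h => (path_zero z s ▸ h 0 (Nat.zero_le m)).not_ge hz
  rw [hempty, measureReal_empty]

theorem fairCoins_real_confined_le_mul_pow {a : ℕ} (ha : 1 ≤ a) (m : ℕ) {z : ℤ} (hz : |z| ≤ a) :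
    (fairCoins ℕ).real {s | ∀ k ≤ m, |path z s k| < a} * (a : ℝ) ^ 2
      ≤ (2 * (a : ℝ) ^ 2 - (z : ℝ) ^ 2) * (1 - 1 / (2 * (a : ℝ) ^ 2)) ^ m := by
  have hone : (1 : ℝ) ≤ a := by exact_mod_cast ha
  have hzsq : (z : ℝ) ^ 2 ≤ (a : ℝ) ^ 2 := sq_le_sq.2 (by rw [Nat.abs_cast]; exact_mod_cast hz)
  have hr : (0 : ℝ) ≤ 1 - 1 / (2 * (a : ℝ) ^ 2) := by
    rw [sub_nonneg, div_le_one (by positivity)]; nlinarith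
  induction m generalizing z with
  | zero =>
    have : (fairCoins ℕ).real {s | ∀ k ≤ 0, |path z s k| < a} ≤ 1 := measureReal_le_one
    nlinarith
  | succ m ih =>
    rcases hz.lt_or_eq with hlt | heq
    · have hsq {w : ℤ} (hw : |w| ≤ a) : (w : ℝ) ^ 2 ≤ (a : ℝ) ^ 2 :=
        sq_le_sq.2 (by rw [Nat.abs_cast]; exact_mod_cast hw)
      have hup : |z + 1| ≤ a := by rw [abs_lt] at hlt; rw [abs_le]; omega
      have hdown : |z - 1| ≤ a := by rw [abs_lt] at hlt; rw [abs_le]; omega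
      have ihup := ih hup (hsq hup)
      have ihdown := ih hdown (hsq hdown)
      push_cast at ihup ihdown
      rw [fairCoins_real_confined_succ hlt]
      set r := 1 - 1 / (2 * (a : ℝ) ^ 2) with hrdef
      have hdecay : 2 * (a : ℝ) ^ 2 - (z : ℝ) ^ 2 - 1 ≤ (2 * (a : ℝ) ^ 2 - (z : ℝ) ^ 2) * r := by
        have : (2 * (a : ℝ) ^ 2 - (z : ℝ) ^ 2) * (1 / (2 * (a : ℝ) ^ 2)) ≤ 1 := by
          rw [mul_one_div, div_le_one (by positivity)]; nlinarith [sq_nonneg (z : ℝ)]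
        rw [hrdef]; linarith
      rw [pow_succ' r m]
      linarith [mul_le_mul_of_nonneg_right hdecay (pow_nonneg hr m)]
    · rw [fairCoins_real_confined_eq_zero heq.ge, zero_mul]
      exact mul_nonneg (by nlinarith) (pow_nonneg hr _)

theorem fairCoins_real_confined_le_exp {a : ℕ} (ha : 1 ≤ a) (m : ℕ) :
    (fairCoins ℕ).real {s | ∀ k ≤ m, |path 0 s k| < a}
      ≤ 2 * Real.exp (-(m / (2 * (a : ℝ) ^ 2))) := by
  have hone : (1 : ℝ) ≤ a := by exact_mod_cast ha
  have hr : (0 : ℝ) ≤ 1 - 1 / (2 * (a : ℝ) ^ 2) := by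
    rw [sub_nonneg, div_le_one (by positivity)]; nlinarith
  have hpow : (1 - 1 / (2 * (a : ℝ) ^ 2)) ^ m ≤ Real.exp (-(m / (2 * (a : ℝ) ^ 2))) := calc
    _ ≤ Real.exp (-(1 / (2 * (a : ℝ) ^ 2))) ^ m := by
      gcongr
      linarith [Real.add_one_le_exp (-(1 / (2 * (a : ℝ) ^ 2)))]
    _ = _ := by rw [← Real.exp_nat_mul]; congr 1; ring
  have hle := fairCoins_real_confined_le_mul_pow ha m (z := 0) (by simp)
  refine le_of_mul_le_mul_right (hle.trans ?_) (by positivity : (0 : ℝ) < (a : ℝ) ^ 2)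
  have := mul_le_mul_of_nonneg_left hpow (sq_nonneg (a : ℝ))
  push_cast
  linarith

/-! ### Followers -/

/-- The symbol observed when an edge of the environment `e` is crossed from `z`, upwards if `b`
and downwards otherwise. The edge from `z` to `z + 1` carries the bit `e z`; crossed downwards, it
shows the opposite bit. -/
def crossing (e : ℤ → Bool) (z : ℤ) (b : Bool) : Bool := if b then e z else !e (z - 1)

/-- Some `n`-step path from `q` in the environment `e'` shows the same symbols as the path
with steps `s` from `z` in the environment `e`. -/
def HasFollower (e' e : ℤ → Bool) (z : ℤ) (s : ℕ → Bool) (q : ℤ) (n : ℕ) : Prop :=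
  ∃ τ : ℕ → Bool, ∀ i < n, crossing e' (path q τ i) (τ i) = crossing e (path z s i) (s i)

section Followers

variable {e' e : ℤ → Bool} {z q : ℤ} {s : ℕ → Bool} {n m : ℕ}

theorem HasFollower.mono (h : HasFollower e' e z s q m) (hnm : n ≤ m) :
    HasFollower e' e z s q n :=
  let ⟨τ, hτ⟩ := h
  ⟨τ, fun i hi => hτ i (hi.trans_le hnm)⟩

theorem HasFollower.congr {s' : ℕ → Bool} (hs : ∀ i < n, s i = s' i)
    (h : HasFollower e' e z s q n) : HasFollower e' e z s' q n := by
  obtain ⟨τ, hτ⟩ := h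
  refine ⟨τ, fun i hi => ?_⟩
  rw [hτ i hi, hs i hi, path_congr z fun k hk => hs k (hk.trans hi)]

theorem dependsOn_hasFollower (e' e : ℤ → Bool) (z q : ℤ) (n : ℕ) :
    DependsOn (fun s => s ∈ {s | HasFollower e' e z s q n}) (Set.Iio n) :=
  dependsOn_mem_of_imp fun _ _ h hs => hs.congr h

theorem measurableSet_hasFollower (e' e : ℤ → Bool) (z q : ℤ) (n : ℕ) :
    MeasurableSet {s | HasFollower e' e z s q n} :=
  measurableSet_of_dependsOn_finite (Set.finite_Iio n) (dependsOn_hasFollower e' e z q n)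

theorem HasFollower.exists_shift (h : HasFollower e' e z s q (n + m)) :
    ∃ q', |q' - q| ≤ n ∧ HasFollower e' e (path z s n) (shift n s) q' m := by
  obtain ⟨τ, hτ⟩ := h
  refine ⟨path q τ n, abs_path_sub_le q τ n, shift n τ, fun i hi => ?_⟩
  rw [← path_add, ← path_add]
  exact hτ (n + i) (by omega)

theorem exists_mem_forall_of_antitone {α : Type*} {F : Finset α} {p : α → ℕ → Prop}
    (hp : ∀ q n m, n ≤ m → p q m → p q n) (h : ∀ n, ∃ q ∈ F, p q n) : ∃ q ∈ F, ∀ n, p q n := by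
  by_contra! hc
  choose! N hN using hc
  obtain ⟨q, hq, hpq⟩ := h (F.sup N)
  exact hN q hq (hp q _ _ (Finset.le_sup hq) hpq)

theorem exists_forall_hasFollower_shift (h : ∀ n, HasFollower e' e z s q n) (n : ℕ) :
    ∃ q', |q' - q| ≤ n ∧ ∀ m, HasFollower e' e (path z s n) (shift n s) q' m := by
  have hex (m : ℕ) : ∃ q' ∈ Finset.Icc (q - n) (q + n),
      HasFollower e' e (path z s n) (shift n s) q' m := by
    obtain ⟨q', hq', hm⟩ := (h (n + m)).exists_shift
    rw [abs_le] at hq'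
    exact ⟨q', by rw [Finset.mem_Icc]; omega, hm⟩
  obtain ⟨q', hq', hm⟩ := exists_mem_forall_of_antitone (fun _ _ _ hnm h => h.mono hnm) hex
  rw [Finset.mem_Icc] at hq'
  exact ⟨q', by rw [abs_le]; omega, hm⟩

theorem fairCoins_forall_hasFollower_eq_zero {z₀ : ℤ}
    (h : fairCoins ℕ {s | ∃ q, ∀ n, HasFollower e' e z₀ s q n} < 1) (z q : ℤ) :
    fairCoins ℕ {s | ∀ n, HasFollower e' e z s q n} = 0 := by
  simp only [Set.ofPred_forall]
  refine fairCoins_iInter_eq_zero_of_restart (T := fun n => {s | path z s n = z₀})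
    (dependsOn_hasFollower e' e z q) (fun n m hnm s hs => HasFollower.mono hs hnm) (fun n => ?_)
    (ae_frequently_path_eq z z₀) ?_ h fun s hs n hn => ?_
  · exact dependsOn_mem_of_imp fun _ _ h hs => (path_congr z h).symm.trans hs
  · simp only [Set.ofPred_exists, Set.ofPred_forall]
    exact MeasurableSet.iUnion fun q => MeasurableSet.iInter fun n =>
      measurableSet_hasFollower e' e z₀ q n
  · obtain ⟨q', -, hq'⟩ := exists_forall_hasFollower_shift (fun n => Set.mem_iInter.1 hs n) n
    rw [show path z s n = z₀ from hn] at hq'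
    exact ⟨q', hq'⟩

end Followers

/-! ### Exit times -/

/-- The walk with steps `u`, started at `0`, leaves the open interval `(-l, r)` at time `t`. -/
def IsExitTime (l r : ℤ) (u : ℕ → Bool) (t : ℕ) : Prop :=
  (∀ i < t, path 0 u i ∈ Set.Ioo (-l) r) ∧ path 0 u t ∉ Set.Ioo (-l) r

section ExitTimes

variable {l r l' r' : ℤ} {u : ℕ → Bool} {t t' : ℕ}

theorem IsExitTime.congr {u' : ℕ → Bool} (hu : ∀ i < t, u i = u' i) (h : IsExitTime l r u t) :
    IsExitTime l r u' t := by
  have hp : ∀ i ≤ t, path 0 u i = path 0 u' i := fun i hi =>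
    path_congr 0 fun k hk => hu k (hk.trans_le hi)
  exact ⟨fun i hi => hp i hi.le ▸ h.1 i hi, hp t le_rfl ▸ h.2⟩

theorem IsExitTime.unique (h : IsExitTime l r u t) (h' : IsExitTime l r u t') : t = t' :=
  le_antisymm (not_lt.1 fun hlt => h'.2 (h.1 t' hlt)) (not_lt.1 fun hlt => h.2 (h'.1 t hlt))

theorem IsExitTime.path_mem_Icc (h : IsExitTime l r u t) (hl : 0 ≤ l) (hr : 0 ≤ r) :
    path 0 u t ∈ Set.Icc (-l) r := by
  cases t with
  | zero => simpa using ⟨hl, hr⟩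
  | succ t =>
    have := h.1 t (Nat.lt_succ_self t)
    rw [Set.mem_Ioo] at this
    rw [path_succ, Set.mem_Icc]
    rcases step_eq_or (u t) with h | h <;> rw [h] <;> constructor <;> omega

theorem IsExitTime.lt (h : IsExitTime l r u t) (h' : IsExitTime l' r' u t') (hl : 0 ≤ l)
    (hr : 0 ≤ r) (hl' : l < l') (hr' : r < r') : t < t' := by
  by_contra! hle
  refine h'.2 ?_
  rcases hle.lt_or_eq with hlt | rfl
  · exact Set.Ioo_subset_Ioo (by omega) hr'.le (h.1 t' hlt)
  · exact Set.Icc_subset_Ioo (by omega) hr' (h.path_mem_Icc hl hr)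

theorem exists_isExitTime {m : ℕ} (h : ∃ i ≤ m, path 0 u i ∉ Set.Ioo (-l) r) :
    ∃ t ≤ m, IsExitTime l r u t := by
  classical
  obtain ⟨i, hi, hi'⟩ := h
  have hex : ∃ i, path 0 u i ∉ Set.Ioo (-l) r := ⟨i, hi'⟩
  exact ⟨Nat.find hex, (Nat.find_min' hex hi').trans hi,
    fun k hk => not_not.1 (Nat.find_min hex hk), Nat.find_spec hex⟩

end ExitTimes

/-! ### Corners -/

/-- The `k`-th of five coin sequences. Sequences `0` and `1` stand for the environment to the right
and to the left of a site, `2` and `3` for the other environment around the site of the follower,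
and `4` for the steps of the walk. -/
def row (ω : Fin 5 × ℕ → Bool) (k : Fin 5) : ℕ → Bool := fun i => ω (k, i)

/-- The times at which the first four paths leave `(-j, j)` and, in the last entry, the time at
which the walk leaves the valley bounded by the first two of them. -/
def IsLevelTimes (ω : Fin 5 × ℕ → Bool) (j : ℕ) (t : Fin 5 → ℕ) : Prop :=
  (∀ k ≠ 4, IsExitTime j j (row ω k) (t k)) ∧ IsExitTime (t 1) (t 0) (row ω 4) (t 4)

/-- Whether the step after time `n` leads away from the origin. -/
def stepsOutward (u : ℕ → Bool) (n : ℕ) : Bool := u n == decide (0 < path 0 u n)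

/-- The directions at a corner: the first environment and the walk continue outwards, the other
environment turns back on both sides, so that no follower can continue. -/
def cornerPattern : Fin 5 → Bool := ![true, true, false, false, true]

/-- The next steps of the five sequences after the times `t` form a corner. -/
def IsCorner (ω : Fin 5 × ℕ → Bool) (t : Fin 5 → ℕ) : Prop :=
  ∀ k, stepsOutward (row ω k) (t k) = cornerPattern k

/-- There is no corner at the levels `1, …, j - 1`. -/
def NoCorner (ω : Fin 5 × ℕ → Bool) (j : ℕ) : Prop :=
  ∀ i, 1 ≤ i → i < j → ∀ t, IsLevelTimes ω i t → ¬IsCorner ω t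

section Corners

variable {ω ω' : Fin 5 × ℕ → Bool} {i j : ℕ} {t t' : Fin 5 → ℕ}

theorem stepsOutward_congr {u u' : ℕ → Bool} {n : ℕ} (h : ∀ i ≤ n, u i = u' i) :
    stepsOutward u n = stepsOutward u' n := by
  rw [stepsOutward, stepsOutward, h n le_rfl, path_congr 0 fun i hi => h i hi.le]

theorem IsLevelTimes.congr (hω : ∀ k, ∀ i < t k, ω (k, i) = ω' (k, i)) (h : IsLevelTimes ω j t) :
    IsLevelTimes ω' j t :=
  ⟨fun k hk => (h.1 k hk).congr (hω k), h.2.congr (hω 4)⟩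

theorem IsLevelTimes.unique (h : IsLevelTimes ω j t) (h' : IsLevelTimes ω j t') : t = t' := by
  have hk : ∀ k ≠ 4, t k = t' k := fun k hk => (h.1 k hk).unique (h'.1 k hk)
  have hwalk := h.2
  rw [hk 0 (by decide), hk 1 (by decide)] at hwalk
  funext k
  rcases eq_or_ne k 4 with rfl | hne
  · exact hwalk.unique h'.2
  · exact hk k hne

theorem IsLevelTimes.lt (h : IsLevelTimes ω i t) (h' : IsLevelTimes ω j t') (hij : i < j)
    (k : Fin 5) : t k < t' k := by
  have hk : ∀ k ≠ 4, t k < t' k := fun k hk =>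
    (h.1 k hk).lt (h'.1 k hk) (by omega) (by omega) (by omega) (by omega)
  rcases eq_or_ne k 4 with rfl | hne
  · have hright := hk 0 (by decide)
    have hleft := hk 1 (by decide)
    exact h.2.lt h'.2 (by omega) (by omega) (by omega) (by omega)
  · exact hk k hne

theorem exists_isLevelTimes {b : Fin 5 → ℕ}
    (hb : ∀ k ≠ 4, ∃ i ≤ b k, path 0 (row ω k) i ∉ Set.Ioo (-j : ℤ) j)
    (hwalk : ∃ i ≤ b 4, path 0 (row ω 4) i ∉ Set.Ioo (-b 1 : ℤ) (b 0)) :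
    ∃ t, IsLevelTimes ω j t ∧ ∀ k, t k ≤ b k := by
  choose! τ hτb hτ using fun k hk => exists_isExitTime (hb k hk)
  have hvalley : Set.Ioo (-τ 1 : ℤ) (τ 0) ⊆ Set.Ioo (-b 1 : ℤ) (b 0) := by
    have hright := hτb 0 (by decide)
    have hleft := hτb 1 (by decide)
    exact Set.Ioo_subset_Ioo (by omega) (by omega)
  obtain ⟨i, hi, hout⟩ := hwalk
  obtain ⟨t₄, ht₄b, ht₄⟩ := exists_isExitTime ⟨i, hi, fun hc => hout (hvalley hc)⟩
  refine ⟨Function.update τ 4 t₄, ⟨fun k hk => ?_, ?_⟩, fun k => ?_⟩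
  · rw [Function.update_of_ne hk]; exact hτ k hk
  · simpa using ht₄
  · rcases eq_or_ne k 4 with rfl | hne
    · simpa using ht₄b
    · rw [Function.update_of_ne hne]; exact hτb k hne

theorem IsLevelTimes.exists_of_le (h : IsLevelTimes ω j t) (hij : i ≤ j) :
    ∃ t', IsLevelTimes ω i t' ∧ ∀ k, t' k ≤ t k := by
  refine exists_isLevelTimes (fun k hk => ⟨t k, le_rfl, fun hc => (h.1 k hk).2 ?_⟩)
    ⟨t 4, le_rfl, h.2.2⟩
  exact Set.Ioo_subset_Ioo (by omega) (by omega) hc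

theorem NoCorner.congr (hω : ∀ k, ∀ i < t k, ω (k, i) = ω' (k, i)) (h : IsLevelTimes ω j t)
    (hn : NoCorner ω j) : NoCorner ω' j := by
  intro i hi hij t' ht' hc
  have hlt := ht'.lt (h.congr hω) hij
  have hω' : ∀ k, ∀ l ≤ t' k, ω (k, l) = ω' (k, l) := fun k l hl => hω k l (hl.trans_lt (hlt k))
  exact hn i hi hij t' (ht'.congr fun k l hl => (hω' k l hl.le).symm) fun k =>
    (stepsOutward_congr (hω' k)).trans (hc k)

theorem NoCorner.mono (h : NoCorner ω j) (hij : i ≤ j) : NoCorner ω i :=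
  fun l hl hli => h l hl (hli.trans_le hij)

end Corners

/-- The event that level `j` is reached without a corner before, at the times `p.1`, where the
paths are on the sides `p.2` of the origin. The coins that decide whether level `j` shows a corner
are untouched by it. -/
def cornerFreeCell (j : ℕ) (p : (Fin 5 → ℕ) × (Fin 5 → Bool)) : Set (Fin 5 × ℕ → Bool) :=
  {ω | NoCorner ω j ∧ IsLevelTimes ω j p.1 ∧ ∀ k, decide (0 < path 0 (row ω k) (p.1 k)) = p.2 k}

section CornerFreeCells

variable (j : ℕ) (p : (Fin 5 → ℕ) × (Fin 5 → Bool))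

theorem dependsOn_cornerFreeCell :
    DependsOn (fun ω => ω ∈ cornerFreeCell j p) {x | x.2 < p.1 x.1} := by
  refine dependsOn_mem_of_imp fun ω ω' h hω => ?_
  obtain ⟨hno, ht, hside⟩ := hω
  have h' : ∀ k, ∀ i < p.1 k, ω (k, i) = ω' (k, i) := fun k i hi => h (k, i) hi
  exact ⟨hno.congr h' ht, ht.congr h', fun k =>
    (congrArg (fun w : ℤ => decide (0 < w)) (path_congr 0 (h' k))).symm.trans (hside k)⟩

theorem measurableSet_cornerFreeCell : MeasurableSet (cornerFreeCell j p) := by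
  refine measurableSet_of_dependsOn_finite ?_ (dependsOn_cornerFreeCell j p)
  refine (Set.finite_univ.prod (Set.finite_Iio (∑ k, p.1 k))).subset fun x hx => ⟨trivial, ?_⟩
  exact lt_of_lt_of_le hx (Finset.single_le_sum (f := p.1) (fun k _ => Nat.zero_le _)
    (Finset.mem_univ x.1))

theorem pairwise_disjoint_cornerFreeCell :
    Pairwise (Function.onFun Disjoint (cornerFreeCell j)) := by
  intro p p' hne
  rw [Function.onFun, Set.disjoint_left]
  rintro ω ⟨-, ht, hside⟩ ⟨-, ht', hside'⟩
  have htime : p.1 = p'.1 := ht.unique ht'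
  exact hne (Prod.ext htime (funext fun k => by rw [← hside k, ← hside' k, htime]))

theorem iUnion_cornerFreeCell :
    ⋃ p, cornerFreeCell j p = {ω | NoCorner ω j ∧ ∃ t, IsLevelTimes ω j t} := by
  ext ω
  simp only [Set.mem_iUnion, Set.mem_ofPred_eq]
  constructor
  · rintro ⟨p, hno, ht, -⟩
    exact ⟨hno, p.1, ht⟩
  · rintro ⟨hno, t, ht⟩
    exact ⟨(t, fun k => decide (0 < path 0 (row ω k) (t k))), hno, ht, fun k => rfl⟩

theorem isCorner_iff_of_mem_cornerFreeCell {j p} {ω : Fin 5 × ℕ → Bool}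
    (hω : ω ∈ cornerFreeCell j p) :
    IsCorner ω p.1 ↔ ∀ x ∈ Finset.univ.image fun k => (k, p.1 k),
      ω x = (p.2 x.1 == cornerPattern x.1) := by
  have hxnor : ∀ a b c : Bool, (a == b) = c ↔ a = (b == c) := by decide
  simp only [Finset.mem_image, Finset.mem_univ, true_and, forall_exists_index,
    forall_apply_eq_imp_iff, IsCorner, stepsOutward, hω.2.2, hxnor]
  rfl

end CornerFreeCells

theorem fairCoins_isCorner (j : ℕ) :
    fairCoins (Fin 5 × ℕ) {ω | NoCorner ω j ∧ ∃ t, IsLevelTimes ω j t ∧ IsCorner ω t}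
      = 2⁻¹ ^ 5 * fairCoins (Fin 5 × ℕ) {ω | NoCorner ω j ∧ ∃ t, IsLevelTimes ω j t} := by
  rw [← iUnion_cornerFreeCell, ← fairCoins_iUnion_cylinder_inter
    (pairwise_disjoint_cornerFreeCell j) (measurableSet_cornerFreeCell j)
    (I := fun p => Finset.univ.image fun k => (k, p.1 k)) ?_ ?_
    fun p x => (p.2 x.1 == cornerPattern x.1)]
  · congr 1
    ext ω
    simp only [Set.mem_iUnion, Set.mem_inter_iff, Set.mem_ofPred_eq]
    constructor
    · rintro ⟨hno, t, ht, hc⟩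
      have hω : ω ∈ cornerFreeCell j (t, fun k => decide (0 < path 0 (row ω k) (t k))) :=
        ⟨hno, ht, fun k => rfl⟩
      exact ⟨_, (isCorner_iff_of_mem_cornerFreeCell hω).1 hc, hω⟩
    · rintro ⟨p, hc, hω⟩
      exact ⟨hω.1, p.1, hω.2.1, (isCorner_iff_of_mem_cornerFreeCell hω).2 hc⟩
  · intro p
    rw [Finset.card_image_of_injective _ fun a b h => (Prod.ext_iff.1 h).1]
    rfl
  · refine fun p => (dependsOn_cornerFreeCell j p).mono fun x hx hmem => ?_
    simp only [Finset.coe_image, Set.mem_image] at hmem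
    obtain ⟨k, -, rfl⟩ := hmem
    exact lt_irrefl (p.1 k) hx

theorem fairCoins_real_noCorner_le (j : ℕ) :
    (fairCoins (Fin 5 × ℕ)).real {ω | NoCorner ω (j + 1) ∧ ∃ t, IsLevelTimes ω (j + 1) t}
      ≤ (31 / 32) ^ j := by
  induction j with
  | zero => simp
  | succ j ih =>
    set A := {ω | NoCorner ω (j + 1) ∧ ∃ t, IsLevelTimes ω (j + 1) t} with hA
    set A' := {ω | NoCorner ω (j + 1 + 1) ∧ ∃ t, IsLevelTimes ω (j + 1 + 1) t} with hA'
    set X := {ω | NoCorner ω (j + 1) ∧ ∃ t, IsLevelTimes ω (j + 1) t ∧ IsCorner ω t}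
    have hX : (fairCoins (Fin 5 × ℕ)).real X = 1 / 32 * (fairCoins (Fin 5 × ℕ)).real A := by
      rw [measureReal_def, fairCoins_isCorner, ENNReal.toReal_mul, ENNReal.toReal_pow,
        ENNReal.toReal_inv, ← measureReal_def, ← hA]
      norm_num
    have hsub : A' ∪ X ⊆ A := by
      rintro ω (⟨hno, t, ht⟩ | ⟨hno, t, ht, -⟩)
      · obtain ⟨t', ht', -⟩ := ht.exists_of_le (Nat.le_succ (j + 1))
        exact ⟨hno.mono (Nat.le_succ _), t', ht'⟩
      · exact ⟨hno, t, ht⟩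
    have hdisj : Disjoint A' X := Set.disjoint_left.2 fun ω hω ⟨_, t, ht, hc⟩ =>
      hω.1 (j + 1) (Nat.le_add_left 1 j) (Nat.lt_succ_self _) t ht hc
    have hm : MeasurableSet A' := by
      rw [hA', ← iUnion_cornerFreeCell]
      exact MeasurableSet.iUnion (measurableSet_cornerFreeCell _)
    have hle := measureReal_mono (μ := fairCoins (Fin 5 × ℕ)) hsub
    rw [measureReal_union' hdisj hm, hX] at hle
    rw [pow_succ]
    linarith

theorem fairCoins_real_row_confined_le (k : Fin 5) {a : ℕ} (ha : 1 ≤ a) (m : ℕ) :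
    (fairCoins (Fin 5 × ℕ)).real {ω | ∀ i ≤ m, |path 0 (row ω k) i| < a}
      ≤ 2 * Real.exp (-(m / (2 * (a : ℝ) ^ 2))) := by
  have hmap := fairCoins_map_comp_xor (Prod.mk_right_injective (β := ℕ) k) fun _ => false
  simp only [Bool.xor_false] at hmap
  refine le_of_eq_of_le ?_ (fairCoins_real_confined_le_exp ha m)
  rw [← hmap, map_measureReal_apply (measurable_pi_lambda _ fun i => measurable_pi_apply (k, i))
    (measurableSet_confined _ _ _)]
  rfl

/-- The coin sequences that do not show a corner below level `J` although level `J` is reached in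
time `J ^ 7`, together with those that do not reach level `J` in this time. -/
def cornerless (J : ℕ) : Set (Fin 5 × ℕ → Bool) :=
  {ω | ∀ t, IsLevelTimes ω J t → (∀ k, t k ≤ J ^ 7) → NoCorner ω J}

theorem dependsOn_cornerless (J : ℕ) :
    DependsOn (fun ω => ω ∈ cornerless J) {x | x.2 < J ^ 7} := by
  refine dependsOn_mem_of_imp fun ω ω' h hω t ht hle => ?_
  have h' : ∀ k, ∀ i < t k, ω (k, i) = ω' (k, i) := fun k i hi => h (k, i) (hi.trans_le (hle k))
  have ht' := ht.congr fun k i hi => (h' k i hi).symm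
  exact (hω t ht' hle).congr h' ht'

/-- Each environment leaves `(-J, J)` by time `J ^ 3` unless it is confined to it, and the walk then
leaves the valley by time `J ^ 7` unless it is confined to `(-J ^ 3, J ^ 3)`. -/
theorem cornerless_subset {J : ℕ} (hJ : 1 ≤ J) :
    cornerless J ⊆ {ω | NoCorner ω J ∧ ∃ t, IsLevelTimes ω J t} ∪
      ((⋃ k, {ω | ∀ i ≤ J ^ 3, |path 0 (row ω k) i| < J}) ∪
        {ω | ∀ i ≤ J ^ 7, |path 0 (row ω 4) i| < (J ^ 3 : ℕ)}) := by
  refine fun ω hω => or_iff_not_imp_right.2 fun hc => ?_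
  simp only [Set.mem_union, Set.mem_iUnion, Set.mem_ofPred_eq, not_or, not_exists, not_forall,
    not_lt] at hc
  obtain ⟨henv, i, hi, hwalk⟩ := hc
  obtain ⟨t, ht, hle⟩ := exists_isLevelTimes (ω := ω) (j := J)
    (b := ![J ^ 3, J ^ 3, J ^ 3, J ^ 3, J ^ 7])
    (fun k hk => by
      obtain ⟨i, hi, hout⟩ := henv k
      refine ⟨i, hi.trans ?_, fun hin => hout.not_gt (abs_lt.2 hin)⟩
      fin_cases k <;> simp_all)
    ⟨i, hi, fun hin => hwalk.not_gt (abs_lt.2 hin)⟩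
  refine ⟨hω t ht fun k => (hle k).trans ?_, t, ht⟩
  have : J ^ 3 ≤ J ^ 7 := Nat.pow_le_pow_right hJ (by norm_num)
  fin_cases k <;> simp [this]

theorem exp_neg_half_le_pow (J : ℕ) : Real.exp (-(J / 2)) ≤ (31 / 32) ^ J := by
  have hone : Real.exp (-1 / 2) ≤ 31 / 32 := by
    have hinv : Real.exp (1 / 2) * Real.exp (-1 / 2) = 1 := by rw [← Real.exp_add]; norm_num
    nlinarith [Real.exp_pos (-1 / 2 : ℝ), Real.add_one_le_exp (1 / 2 : ℝ)]
  calc Real.exp (-(J / 2)) = Real.exp (-1 / 2) ^ J := by rw [← Real.exp_nat_mul]; congr 1; ring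
    _ ≤ (31 / 32) ^ J := pow_le_pow_left₀ (Real.exp_pos _).le hone J

theorem fairCoins_real_cornerless_le {J : ℕ} (hJ : 1 ≤ J) :
    (fairCoins (Fin 5 × ℕ)).real (cornerless J) ≤ 16 * (31 / 32) ^ J := by
  have hexp := exp_neg_half_le_pow J
  have hJ' : (0 : ℝ) < J := by positivity
  have henv (k : Fin 5) : (fairCoins (Fin 5 × ℕ)).real
      {ω | ∀ i ≤ J ^ 3, |path 0 (row ω k) i| < J} ≤ 2 * (31 / 32) ^ J := by
    refine (fairCoins_real_row_confined_le k hJ (J ^ 3)).trans ?_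
    rw [show ((J ^ 3 : ℕ) : ℝ) / (2 * (J : ℝ) ^ 2) = J / 2 by push_cast; field_simp]
    linarith
  have hwalk : (fairCoins (Fin 5 × ℕ)).real
      {ω | ∀ i ≤ J ^ 7, |path 0 (row ω 4) i| < (J ^ 3 : ℕ)} ≤ 2 * (31 / 32) ^ J := by
    refine (fairCoins_real_row_confined_le 4 (Nat.one_le_pow _ _ hJ) (J ^ 7)).trans ?_
    rw [show ((J ^ 7 : ℕ) : ℝ) / (2 * ((J ^ 3 : ℕ) : ℝ) ^ 2) = J / 2 by push_cast; field_simp]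
    linarith
  have henvs : (fairCoins (Fin 5 × ℕ)).real
      (⋃ k, {ω | ∀ i ≤ J ^ 3, |path 0 (row ω k) i| < J}) ≤ 10 * (31 / 32) ^ J := by
    refine (measureReal_iUnion_fintype_le _).trans ((Finset.sum_le_sum fun k _ => henv k).trans ?_)
    rw [Finset.sum_const, Finset.card_univ, Fintype.card_fin, nsmul_eq_mul]
    exact le_of_eq (by push_cast; ring)
  have hno : (fairCoins (Fin 5 × ℕ)).real {ω | NoCorner ω J ∧ ∃ t, IsLevelTimes ω J t}
      ≤ 2 * (31 / 32) ^ J := by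
    obtain ⟨i, rfl⟩ : ∃ i, J = i + 1 := ⟨J - 1, by omega⟩
    refine (fairCoins_real_noCorner_le i).trans ?_
    rw [pow_succ]
    linarith [pow_pos (by norm_num : (0 : ℝ) < 31 / 32) i]
  calc _ ≤ _ := measureReal_mono (cornerless_subset hJ)
    _ ≤ _ := measureReal_union_le _ _
    _ ≤ _ := add_le_add le_rfl (measureReal_union_le _ _)
    _ ≤ 16 * (31 / 32) ^ J := by linarith [pow_pos (by norm_num : (0 : ℝ) < 31 / 32) J]

/-! ### The height of an environment -/

/-- The environment `e` seen from `b` to the right, as a sequence of steps. -/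
def toRight (e : ℤ → Bool) (b : ℤ) : ℕ → Bool := fun i => e (b + i)

/-- The environment `e` seen from `b` to the left, as a sequence of steps. Edges are crossed
downwards, hence the negation. -/
def toLeft (e : ℤ → Bool) (b : ℤ) : ℕ → Bool := fun i => !e (b - 1 - i)

/-- The height of the site `z` over the site `b` in the landscape whose slopes are given by the
environment `e`. The truncated differences make one of the two terms vanish. -/
def height (e : ℤ → Bool) (b z : ℤ) : ℤ :=
  path 0 (toRight e b) (z - b).toNat + path 0 (toLeft e b) (b - z).toNat

section Height

variable {e e' : ℤ → Bool} {b q : ℤ}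

theorem height_add (e : ℤ → Bool) (b : ℤ) (i : ℕ) :
    height e b (b + i) = path 0 (toRight e b) i := by
  simp [height]

theorem height_sub (e : ℤ → Bool) (b : ℤ) (i : ℕ) :
    height e b (b - i) = path 0 (toLeft e b) i := by
  simp [height]

theorem height_self (e : ℤ → Bool) (b : ℤ) : height e b b = 0 := by simp [height]

theorem height_succ (e : ℤ → Bool) (b z : ℤ) :
    height e b (z + 1) = height e b z + step (e z) := by
  rcases le_or_gt b z with h | h
  · obtain ⟨i, rfl⟩ := Int.le.dest h
    rw [add_assoc, ← Nat.cast_succ, height_add, height_add, path_succ]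
    rfl
  · obtain ⟨i, rfl⟩ : ∃ i : ℕ, z = b - (i + 1 : ℕ) := ⟨(b - z - 1).toNat, by omega⟩
    have hdown : b - ((i + 1 : ℕ) : ℤ) + 1 = b - i := by push_cast; ring
    have hedge : b - ((i + 1 : ℕ) : ℤ) = b - 1 - i := by push_cast; ring
    rw [hdown, height_sub, height_sub, path_succ, hedge, toLeft]
    cases e (b - 1 - i) <;> simp

theorem height_add_step (e : ℤ → Bool) (b z : ℤ) (c : Bool) :
    height e b (z + step c) = height e b z + step (crossing e z c) := by
  cases c
  · have h := height_succ e b (z - 1)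
    rw [sub_add_cancel] at h
    rw [step_false, ← sub_eq_add_neg, h, crossing]
    cases e (z - 1) <;> simp
  · rw [step_true, height_succ]; rfl

theorem height_path_eq_of_crossing_eq {s τ : ℕ → Bool} {n : ℕ}
    (h : ∀ i < n, crossing e' (path q τ i) (τ i) = crossing e (path b s i) (s i)) :
    ∀ i ≤ n, height e' q (path q τ i) = height e b (path b s i) := by
  intro i hi
  induction i with
  | zero => rw [path_zero, path_zero, height_self, height_self]
  | succ i ih =>
    rw [path_succ, path_succ, height_add_step, height_add_step, ih (Nat.le_of_succ_le hi), h i hi]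

end Height

theorem abs_path_succ {u : ℕ → Bool} {n : ℕ} (h : path 0 u n ≠ 0) :
    |path 0 u (n + 1)| = |path 0 u n| + step (stepsOutward u n) := by
  rw [path_succ, stepsOutward]
  rcases lt_or_gt_of_ne h with hneg | hpos
  · rw [decide_eq_false hneg.not_gt, abs_of_neg hneg]
    cases u n
    · rw [step_false, abs_of_neg (by omega)]; simp; ring
    · rw [step_true, abs_of_nonpos (by omega)]; simp; ring
  · rw [decide_eq_true hpos, abs_of_pos hpos]
    cases u n
    · rw [step_false, abs_of_nonneg (by omega)]; simp
    · rw [step_true, abs_of_pos (by omega)]; simp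

section Exits

variable {j t : ℕ} {u : ℕ → Bool}

theorem IsExitTime.abs_path_eq (h : IsExitTime j j u t) : |path 0 u t| = j := by
  have hmem := h.path_mem_Icc (by omega) (by omega)
  have hout := h.2
  rw [Set.mem_Icc, ← abs_le] at hmem
  rw [Set.mem_Ioo, ← abs_lt] at hout
  omega

theorem IsExitTime.abs_path_succ (hj : 1 ≤ j) (h : IsExitTime j j u t) :
    |path 0 u (t + 1)| = j + step (stepsOutward u t) := by
  rw [SceneryReconstruction.abs_path_succ (abs_pos.1 (by rw [h.abs_path_eq]; omega)),
    h.abs_path_eq]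

theorem IsExitTime.pos (hj : 1 ≤ j) (h : IsExitTime j j u t) : 0 < t := by
  refine Nat.pos_of_ne_zero fun h0 => ?_
  have hpath := h.abs_path_eq
  rw [h0, path_zero, abs_zero] at hpath
  omega

theorem IsExitTime.abs_path_le_of_inward (hj : 1 ≤ j) (h : IsExitTime j j u t)
    (hin : stepsOutward u t = false) : ∀ i ≤ t + 1, |path 0 u i| ≤ j := by
  intro i hi
  rcases hi.lt_or_eq with hlt | rfl
  · rcases (Nat.lt_succ_iff.1 hlt).lt_or_eq with hlt | rfl
    · exact (abs_lt.2 (h.1 i hlt)).le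
    · exact h.abs_path_eq.le
  · rw [h.abs_path_succ hj, hin, step_false]
    omega

end Exits

section Valley

variable {e : ℤ → Bool} {b : ℤ} {j tᵣ tₗ : ℕ} {s : ℕ → Bool} {n : ℕ}

theorem abs_height_lt_of_mem_Ioo (hr : IsExitTime j j (toRight e b) tᵣ)
    (hl : IsExitTime j j (toLeft e b) tₗ) {z : ℤ} (hz : z ∈ Set.Ioo (b - tₗ) (b + tᵣ)) :
    |height e b z| < j := by
  rw [Set.mem_Ioo] at hz
  obtain ⟨i, hi | hi⟩ := Int.eq_nat_or_neg (z - b)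
  · obtain rfl : z = b + i := by omega
    rw [height_add]
    exact abs_lt.2 (hr.1 i (by omega))
  · obtain rfl : z = b - i := by omega
    rw [height_sub]
    exact abs_lt.2 (hl.1 i (by omega))

theorem abs_height_path_lt (hr : IsExitTime j j (toRight e b) tᵣ)
    (hl : IsExitTime j j (toLeft e b) tₗ) (hs : IsExitTime tₗ tᵣ s n) {i : ℕ} (hi : i < n) :
    |height e b (path b s i)| < j := by
  have hin := hs.1 i hi
  rw [Set.mem_Ioo] at hin
  refine abs_height_lt_of_mem_Ioo hr hl ?_
  rw [path_eq_add]
  constructor <;> linarith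

theorem abs_height_path_exit_succ (hj : 1 ≤ j) (hr : IsExitTime j j (toRight e b) tᵣ)
    (hl : IsExitTime j j (toLeft e b) tₗ) (hs : IsExitTime tₗ tᵣ s n)
    (hr' : stepsOutward (toRight e b) tᵣ = true) (hl' : stepsOutward (toLeft e b) tₗ = true)
    (hs' : stepsOutward s n = true) : |height e b (path b s (n + 1))| = j + 1 := by
  have hrpos := hr.pos hj
  have hlpos := hl.pos hj
  have hexit : path 0 s n = tᵣ ∨ path 0 s n = -(tₗ : ℤ) := by
    have hmem := hs.path_mem_Icc (by omega) (by omega)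
    have hout := hs.2
    rw [Set.mem_Icc] at hmem
    rw [Set.mem_Ioo] at hout
    omega
  rw [stepsOutward, beq_iff_eq] at hs'
  rw [path_eq_add, path_succ, hs']
  rcases hexit with h | h
  · rw [h, decide_eq_true (by omega), step_true, ← Nat.cast_succ, height_add,
      hr.abs_path_succ hj, hr', step_true]
  · rw [h, decide_eq_false (by omega), step_false,
      show b + (-(tₗ : ℤ) + -1) = b - (tₗ + 1 : ℕ) by push_cast; ring, height_sub,
      hl.abs_path_succ hj, hl', step_true]

theorem path_mem_Icc_of_abs_height_lt (hr : IsExitTime j j (toRight e b) tᵣ)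
    (hl : IsExitTime j j (toLeft e b) tₗ) (h : ∀ i < n, |height e b (path b s i)| < j) :
    ∀ i ≤ n, path b s i ∈ Set.Icc (b - tₗ) (b + tᵣ) := by
  intro i hi
  induction i with
  | zero => simp
  | succ i ih =>
    have hin := ih (Nat.le_of_succ_le hi)
    have hlt := h i hi
    have hnr : path b s i ≠ b + tᵣ := fun heq => by
      rw [heq, height_add, hr.abs_path_eq] at hlt; exact lt_irrefl _ hlt
    have hnl : path b s i ≠ b - tₗ := fun heq => by
      rw [heq, height_sub, hl.abs_path_eq] at hlt; exact lt_irrefl _ hlt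
    rw [Set.mem_Icc] at hin ⊢
    rw [path_succ]
    rcases step_eq_or (s i) with hst | hst <;> rw [hst] <;> constructor <;> omega

theorem abs_height_le_of_inward (hj : 1 ≤ j) (hr : IsExitTime j j (toRight e b) tᵣ)
    (hl : IsExitTime j j (toLeft e b) tₗ) (hr' : stepsOutward (toRight e b) tᵣ = false)
    (hl' : stepsOutward (toLeft e b) tₗ = false) {z : ℤ}
    (hz : z ∈ Set.Icc (b - tₗ - 1) (b + tᵣ + 1)) : |height e b z| ≤ j := by
  rw [Set.mem_Icc] at hz
  obtain ⟨i, hi | hi⟩ := Int.eq_nat_or_neg (z - b)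
  · obtain rfl : z = b + i := by omega
    rw [height_add]
    exact hr.abs_path_le_of_inward hj hr' i (by omega)
  · obtain rfl : z = b - i := by omega
    rw [height_sub]
    exact hl.abs_path_le_of_inward hj hl' i (by omega)

end Valley

/-- The five coin sequences that matter for a walk from `b` in the environment `e` and a follower
from `q` in the environment `e'`. -/
def rows (e e' : ℤ → Bool) (b q : ℤ) (s : ℕ → Bool) : Fin 5 × ℕ → Bool := fun x =>
  (![toRight e b, toLeft e b, toRight e' q, toLeft e' q, s] : Fin 5 → ℕ → Bool) x.1 x.2

section Rows

variable {e e' : ℤ → Bool} {b q : ℤ} {s : ℕ → Bool}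

theorem not_hasFollower_of_isCorner {j : ℕ} (hj : 1 ≤ j) {t : Fin 5 → ℕ}
    (ht : IsLevelTimes (rows e e' b q s) j t) (hc : IsCorner (rows e e' b q s) t) :
    ¬HasFollower e' e b s q (t 4 + 1) := by
  rintro ⟨τ, hτ⟩
  have hheight := height_path_eq_of_crossing_eq hτ
  have hr : IsExitTime j j (toRight e b) (t 0) := ht.1 0 (by decide)
  have hl : IsExitTime j j (toLeft e b) (t 1) := ht.1 1 (by decide)
  have hr' : IsExitTime j j (toRight e' q) (t 2) := ht.1 2 (by decide)
  have hl' : IsExitTime j j (toLeft e' q) (t 3) := ht.1 3 (by decide)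
  have hs : IsExitTime (t 1) (t 0) s (t 4) := ht.2
  have hwalk : |height e b (path b s (t 4 + 1))| = j + 1 :=
    abs_height_path_exit_succ hj hr hl hs (hc 0) (hc 1) (hc 4)
  have hfollower : path q τ (t 4) ∈ Set.Icc (q - t 3) (q + t 2) :=
    path_mem_Icc_of_abs_height_lt hr' hl' (fun i hi => by
      rw [hheight i (by omega)]; exact abs_height_path_lt hr hl hs hi) (t 4) le_rfl
  have hlow : |height e' q (path q τ (t 4 + 1))| ≤ j := by
    refine abs_height_le_of_inward hj hr' hl' (hc 2) (hc 3) ?_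
    rw [Set.mem_Icc] at hfollower ⊢
    rw [path_succ]
    rcases step_eq_or (τ (t 4)) with hst | hst <;> rw [hst] <;> constructor <;> omega
  rw [hheight _ le_rfl] at hlow
  omega

theorem not_hasFollower_of_notMem_cornerless {J : ℕ} (h : rows e e' b q s ∉ cornerless J) :
    ¬HasFollower e' e b s q (J ^ 7 + 1) := by
  simp only [cornerless, Set.mem_ofPred_eq, NoCorner, not_forall, not_not] at h
  obtain ⟨t, ht, hle, i, hi, hiJ, t', ht', hc⟩ := h
  have hlt := (ht'.lt ht hiJ 4).trans_le (hle 4)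
  exact fun hf => not_hasFollower_of_isCorner hi ht' hc (hf.mono (by omega))

end Rows

/-! ### Good sites -/

theorem fairCoins_comp_xor_of_dependsOn {κ κ' : Type*} {I : Set κ'} (hI : I.Finite)
    {B : Set (κ' → Bool)} (hB : DependsOn (fun ω => ω ∈ B) I) {j : κ' → κ} (hj : Set.InjOn j I)
    (g : κ' → Bool) : fairCoins κ {ω | (fun i => xor (ω (j i)) (g i)) ∈ B} = fairCoins κ' B := by
  have : Finite I := hI
  obtain ⟨R, rfl⟩ := exists_eq_preimage_domRestrict hB
  have hR : MeasurableSet R := R.toFinite.measurableSet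
  have hsel := fairCoins_map_comp_xor (j := fun i : I => j i)
    (fun a b h => Subtype.ext (hj a.2 b.2 h)) fun i => g i
  have hval := fairCoins_map_comp_xor (j := ((↑) : I → κ')) Subtype.val_injective fun _ => false
  have h := congrArg (fun μ => μ R) (hsel.trans hval.symm)
  rw [Measure.map_apply (measurable_comp_xor _ _) hR,
    Measure.map_apply (measurable_comp_xor _ _) hR] at h
  simp only [Bool.xor_false] at h
  exact h

/-- The environment that differs from `e` at the edges marked by `m`. -/
def twist (m e : ℤ → Bool) : ℤ → Bool := fun z => xor (e z) (m z)

/-- The coin among the edges and the steps that is shown by an entry of `rows`, up to a flip. -/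
def rowsCoin (b q : ℤ) (x : Fin 5 × ℕ) : ℤ ⊕ ℕ :=
  (![.inl (b + x.2), .inl (b - 1 - x.2), .inl (q + x.2), .inl (q - 1 - x.2), .inr x.2] :
    Fin 5 → ℤ ⊕ ℕ) x.1

/-- Whether an entry of `rows` for a twisted environment shows its coin flipped. -/
def rowsFlip (m : ℤ → Bool) (q : ℤ) (x : Fin 5 × ℕ) : Bool :=
  (![false, true, m (q + x.2), !m (q - 1 - x.2), false] : Fin 5 → Bool) x.1

theorem rows_twist (m e : ℤ → Bool) (b q : ℤ) (s : ℕ → Bool) :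
    rows e (twist m e) b q s
      = fun x => xor (Sum.elim e s (rowsCoin b q x)) (rowsFlip m q x) := by
  funext ⟨k, i⟩
  fin_cases k <;> simp [rows, rowsCoin, rowsFlip, twist, toRight, toLeft]

theorem measurable_rows_twist (m : ℤ → Bool) (b q : ℤ) :
    Measurable fun p : (ℤ → Bool) × (ℕ → Bool) => rows p.1 (twist m p.1) b q p.2 := by
  simp only [rows_twist]
  refine measurable_pi_lambda _ fun x => ?_
  refine (measurable_of_finite fun c => xor c (rowsFlip m q x)).comp ?_
  cases rowsCoin b q x with
  | inl z => exact (measurable_pi_apply z).comp measurable_fst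
  | inr i => exact (measurable_pi_apply i).comp measurable_snd

/-- From this distance on, a follower and the walk see disjoint sets of edges in time `J ^ 7`. -/
def farRadius (J : ℕ) : ℕ := 2 * J ^ 7

theorem injOn_rowsCoin {b q : ℤ} {J : ℕ} (hq : farRadius J ≤ |q - b|) :
    Set.InjOn (rowsCoin b q) {x | x.2 < J ^ 7} := by
  rintro ⟨k, i⟩ hi ⟨k', i'⟩ hi' h
  rw [Set.mem_ofPred_eq] at hi hi'
  rw [farRadius, le_abs] at hq
  fin_cases k <;> fin_cases k' <;> simp [rowsCoin] at h ⊢ <;> omega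

theorem finite_setOf_snd_lt (n : ℕ) : {x : Fin 5 × ℕ | x.2 < n}.Finite :=
  (Set.finite_univ.prod (Set.finite_Iio n)).subset fun _ hx => ⟨trivial, hx⟩

theorem measurableSet_cornerless (J : ℕ) : MeasurableSet (cornerless J) :=
  measurableSet_of_dependsOn_finite (finite_setOf_snd_lt _) (dependsOn_cornerless J)

theorem lintegral_fairCoins_cornerless (m : ℤ → Bool) {b q : ℤ} {J : ℕ}
    (hq : farRadius J ≤ |q - b|) :
    ∫⁻ e, fairCoins ℕ {s | rows e (twist m e) b q s ∈ cornerless J} ∂fairCoins ℤ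
      = fairCoins (Fin 5 × ℕ) (cornerless J) := by
  have hmeas : MeasurableSet {p : (ℤ → Bool) × (ℕ → Bool) |
      rows p.1 (twist m p.1) b q p.2 ∈ cornerless J} :=
    measurable_rows_twist m b q (measurableSet_cornerless J)
  have hsum : Measurable fun p : (ℤ → Bool) × (ℕ → Bool) => Sum.elim p.1 p.2 := by
    refine measurable_pi_lambda _ fun i => ?_
    cases i with
    | inl a => exact (measurable_pi_apply a).comp measurable_fst
    | inr b => exact (measurable_pi_apply b).comp measurable_snd
  have hxor := measurable_comp_xor (rowsCoin b q) (rowsFlip m q)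
  rw [← fairCoins_comp_xor_of_dependsOn (finite_setOf_snd_lt _) (dependsOn_cornerless J)
    (injOn_rowsCoin hq) (rowsFlip m q), ← fairCoins_prod_map_sumElim]
  refine (Measure.prod_apply hmeas).symm.trans
    (Eq.trans ?_ (Measure.map_apply hsum (hxor (measurableSet_cornerless J))).symm)
  simp only [rows_twist]
  rfl

/-- The steps of the walks from `b` in the environment `e` that never get rid of the followers in
`e'` starting at distance at least `D`. -/
def farFollowed (e' e : ℤ → Bool) (b : ℤ) (D : ℕ) : Set (ℕ → Bool) :=
  {s | ∃ q, D ≤ |q - b| ∧ ∀ n, HasFollower e' e b s q n}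

/-- A walk from `b` leaves all followers that start at least `farRadius J` away behind with positive
probability. -/
def IsGoodSite (m : ℤ → Bool) (J : ℕ) (b : ℤ) (e : ℤ → Bool) : Prop :=
  fairCoins ℕ (farFollowed (twist m e) e b (farRadius J)) < 1

/-- The sites whose distance from `b` lies between two consecutive far radii. -/
noncomputable def annulus (b : ℤ) (J : ℕ) : Finset ℤ :=
  (Finset.Icc (b - farRadius (J + 1)) (b + farRadius (J + 1))).filter
    fun q => (farRadius J : ℤ) ≤ |q - b|

theorem lt_farRadius_succ (J : ℕ) : J < farRadius (J + 1) := by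
  have : J + 1 ≤ (J + 1) ^ 7 := Nat.le_self_pow (by norm_num) (J + 1)
  rw [farRadius]
  omega

theorem exists_mem_annulus {b q : ℤ} {J₀ : ℕ} (h : farRadius J₀ ≤ |q - b|) :
    ∃ J, q ∈ annulus b (J₀ + J) := by
  classical
  have hex : ∃ J, |q - b| < farRadius (J₀ + J + 1) := by
    refine ⟨(|q - b|).toNat, ?_⟩
    have := lt_farRadius_succ (J₀ + (|q - b|).toNat)
    have := abs_nonneg (q - b)
    omega
  have hupper := abs_lt.1 (Nat.find_spec hex)
  have hlower : (farRadius (J₀ + Nat.find hex) : ℤ) ≤ |q - b| := by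
    rcases Nat.eq_zero_or_pos (Nat.find hex) with h0 | h0
    · rwa [h0]
    · have hprev := Nat.find_min hex (Nat.sub_lt h0 one_pos)
      rwa [add_assoc, show Nat.find hex - 1 + 1 = Nat.find hex by omega, not_lt] at hprev
  exact ⟨Nat.find hex, Finset.mem_filter.2
    ⟨Finset.mem_Icc.2 ⟨by linarith [hupper.1], by linarith [hupper.2]⟩, hlower⟩⟩

theorem card_annulus_le (b : ℤ) (J : ℕ) : (annulus b J).card ≤ 5 * (J + 1) ^ 7 := by
  refine (Finset.card_filter_le _ _).trans ?_
  have : 1 ≤ (J + 1) ^ 7 := Nat.one_le_pow _ _ (by omega)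
  rw [Int.card_Icc, farRadius]
  omega

/-- The expected number of sites `q` in the annuli from level `J₀` on for which no corner shows, in
a given environment. -/
noncomputable def expectedCornerless (m : ℤ → Bool) (J₀ : ℕ) (b : ℤ) (e : ℤ → Bool) : ℝ≥0∞ :=
  ∑' J, ∑ q ∈ annulus b (J₀ + J), fairCoins ℕ {s | rows e (twist m e) b q s ∈ cornerless (J₀ + J)}

section GoodSites

variable (m : ℤ → Bool)

theorem isGoodSite_of_expectedCornerless_lt {J₀ : ℕ} {b : ℤ} {e : ℤ → Bool}
    (h : expectedCornerless m J₀ b e < 1) : IsGoodSite m J₀ b e := by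
  have hsub : farFollowed (twist m e) e b (farRadius J₀) ⊆ ⋃ J, ⋃ q ∈ annulus b (J₀ + J),
      {s | rows e (twist m e) b q s ∈ cornerless (J₀ + J)} := by
    rintro s ⟨q, hq, hs⟩
    obtain ⟨J, hJ⟩ := exists_mem_annulus hq
    refine Set.mem_iUnion.2 ⟨J, Set.mem_iUnion₂.2 ⟨q, hJ, ?_⟩⟩
    by_contra hc
    exact not_hasFollower_of_notMem_cornerless hc (hs _)
  calc _ ≤ _ := measure_mono hsub
    _ ≤ _ := measure_iUnion_le _
    _ ≤ expectedCornerless m J₀ b e :=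
      ENNReal.tsum_le_tsum fun J => measure_biUnion_finset_le _ _
    _ < 1 := h

theorem measurable_fairCoins_cornerless (b q : ℤ) (J : ℕ) :
    Measurable fun e => fairCoins ℕ {s | rows e (twist m e) b q s ∈ cornerless J} :=
  measurable_measure_prodMk_left (measurable_rows_twist m b q (measurableSet_cornerless J))

theorem lintegral_expectedCornerless_le {J₀ : ℕ} (hJ₀ : 1 ≤ J₀) (b : ℤ) :
    ∫⁻ e, expectedCornerless m J₀ b e ∂fairCoins ℤ
      ≤ ∑' J, ENNReal.ofReal (80 * ((J₀ + J : ℕ) + 1) ^ 7 * (31 / 32) ^ (J₀ + J)) := by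
  have hmeas := measurable_fairCoins_cornerless m b
  unfold expectedCornerless
  rw [lintegral_tsum fun J => (Finset.measurable_sum _ fun q _ => hmeas q _).aemeasurable]
  refine ENNReal.tsum_le_tsum fun J => ?_
  rw [lintegral_finsetSum _ fun q _ => hmeas q _]
  have hcell : ∀ q ∈ annulus b (J₀ + J),
      ∫⁻ e, fairCoins ℕ {s | rows e (twist m e) b q s ∈ cornerless (J₀ + J)} ∂fairCoins ℤ
        ≤ ENNReal.ofReal (16 * (31 / 32) ^ (J₀ + J)) := by
    intro q hq
    rw [lintegral_fairCoins_cornerless m (Finset.mem_filter.1 hq).2, ← ofReal_measureReal]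
    exact ENNReal.ofReal_le_ofReal (fairCoins_real_cornerless_le (by omega))
  refine (Finset.sum_le_sum hcell).trans ?_
  rw [Finset.sum_const, nsmul_eq_mul, ← ENNReal.ofReal_natCast,
    ← ENNReal.ofReal_mul (Nat.cast_nonneg _)]
  refine ENNReal.ofReal_le_ofReal ?_
  have hcard : ((annulus b (J₀ + J)).card : ℝ) ≤ 5 * ((J₀ + J : ℕ) + 1) ^ 7 := by
    exact_mod_cast card_annulus_le b (J₀ + J)
  calc _ ≤ 5 * (((J₀ + J : ℕ) : ℝ) + 1) ^ 7 * (16 * (31 / 32) ^ (J₀ + J)) := by gcongr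
    _ = _ := by ring

theorem fairCoins_not_isGoodSite_le {J₀ : ℕ} (hJ₀ : 1 ≤ J₀) (b : ℤ) :
    fairCoins ℤ {e | ¬IsGoodSite m J₀ b e}
      ≤ ∑' J, ENNReal.ofReal (80 * ((J₀ + J : ℕ) + 1) ^ 7 * (31 / 32) ^ (J₀ + J)) := by
  have hmeas : Measurable (expectedCornerless m J₀ b) :=
    Measurable.tsum fun J => Finset.measurable_sum _ fun q _ =>
      measurable_fairCoins_cornerless m b q _
  have hmarkov := mul_meas_ge_le_lintegral₀ (μ := fairCoins ℤ) hmeas.aemeasurable 1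
  rw [one_mul] at hmarkov
  have hsub : {e | ¬IsGoodSite m J₀ b e} ⊆ {e | 1 ≤ expectedCornerless m J₀ b e} :=
    fun e he => not_lt.1 fun hlt => he (isGoodSite_of_expectedCornerless_lt m hlt)
  exact (measure_mono hsub).trans (hmarkov.trans (lintegral_expectedCornerless_le m hJ₀ b))

end GoodSites

theorem summable_pow_mul_geometric : Summable fun J : ℕ =>
    80 * ((J : ℝ) + 1) ^ 21 * (31 / 32) ^ J := by
  have h := summable_pow_mul_geometric_of_norm_lt_one 21 (r := (31 / 32 : ℝ)) (by norm_num)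
  refine (((summable_nat_add_iff 1).2 h).mul_left (80 * (32 / 31))).congr fun J => ?_
  push_cast
  rw [pow_succ (31 / 32 : ℝ) J]
  ring

/-- The factor `J ^ 14` leaves room for a union bound over polynomially many sites. -/
theorem exists_tendsto_pow_mul_not_isGoodSite_le :
    ∃ ε : ℕ → ℝ≥0∞, Filter.Tendsto ε Filter.atTop (nhds 0) ∧ ∀ (m : ℤ → Bool) (J : ℕ) (b : ℤ),
      1 ≤ J → (J : ℝ≥0∞) ^ 14 * fairCoins ℤ {e | ¬IsGoodSite m J b e} ≤ ε J := by
  refine ⟨_, ENNReal.tendsto_sum_nat_add _ summable_pow_mul_geometric.tsum_ofReal_ne_top,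
    fun m J₀ b hJ₀ => ?_⟩
  refine (mul_le_mul_right (fairCoins_not_isGoodSite_le m hJ₀ b) _).trans ?_
  rw [← ENNReal.tsum_mul_left]
  refine ENNReal.tsum_le_tsum fun J => ?_
  rw [← ENNReal.ofReal_natCast, ← ENNReal.ofReal_pow (Nat.cast_nonneg _),
    ← ENNReal.ofReal_mul (by positivity), add_comm J J₀]
  refine ENNReal.ofReal_le_ofReal ?_
  have hle : (J₀ : ℝ) ≤ (J₀ + J : ℕ) + 1 := by
    push_cast
    linarith [(Nat.cast_nonneg J : (0 : ℝ) ≤ J)]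
  calc _ ≤ (((J₀ + J : ℕ) : ℝ) + 1) ^ 14
        * (80 * (((J₀ + J : ℕ) : ℝ) + 1) ^ 7 * (31 / 32) ^ (J₀ + J)) := by gcongr
    _ = _ := by ring

/-! ### Beacons and the escape from all followers -/

theorem crossing_reverse (e : ℤ → Bool) (z : ℤ) (b : Bool) :
    crossing e (z + step b) (!b) = !crossing e z b := by
  cases b <;> simp [crossing, sub_eq_add_neg]

/-- The steps that trace the first `n` of the steps `s` backwards. -/
def reverse (s : ℕ → Bool) (n : ℕ) : ℕ → Bool := fun i => !s (n - 1 - i)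

theorem path_reverse (q : ℤ) (s : ℕ → Bool) {n i : ℕ} (hi : i ≤ n) :
    path (path q s n) (reverse s n) i = path q s (n - i) := by
  induction i with
  | zero => simp
  | succ i ih =>
    have h : n - i = n - 1 - i + 1 := by omega
    rw [path_succ, ih (by omega), h, path_succ, reverse, show n - (i + 1) = n - 1 - i by omega]
    cases s (n - 1 - i) <;> simp

theorem crossing_path_reverse (e : ℤ → Bool) (q : ℤ) (s : ℕ → Bool) {n i : ℕ} (hi : i < n) :
    crossing e (path (path q s n) (reverse s n) i) (reverse s n i)
      = !crossing e (path q s (n - 1 - i)) (s (n - 1 - i)) := by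
  rw [path_reverse q s hi.le, show n - i = n - 1 - i + 1 by omega, path_succ, reverse,
    crossing_reverse]

theorem hasFollower_reverse {e' e : ℤ → Bool} {z q : ℤ} {s τ : ℕ → Bool} {n : ℕ}
    (h : ∀ i < n, crossing e' (path q τ i) (τ i) = crossing e (path z s i) (s i)) :
    HasFollower e' e (path z s n) (reverse s n) (path q τ n) n :=
  ⟨reverse τ n, fun i hi => by
    rw [crossing_path_reverse e' q τ hi, crossing_path_reverse e z s hi, h _ (by omega)]⟩

theorem path_eq_of_const (z : ℤ) {s : ℕ → Bool} {b : Bool} {n : ℕ} (h : ∀ i < n, s i = b) :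
    path z s n = z + n * step b := by
  induction n with
  | zero => simp
  | succ n ih =>
    rw [path_succ, ih fun i hi => h i (by omega), h n (by omega)]
    push_cast
    ring

theorem abs_path_add_sub_le (z : ℤ) (s : ℕ → Bool) (n m : ℕ) :
    |path z s (n + m) - path z s n| ≤ m := by
  rw [path_add]
  exact abs_path_sub_le _ _ _

theorem eq_true_of_path_eq_add {z : ℤ} {s : ℕ → Bool} {n : ℕ} (h : path z s n = z + n) {k : ℕ}
    (hk : k < n) : path z s k = z + k ∧ s k = true := by
  have hstart := abs_path_sub_le z s k
  have hrest := abs_path_add_sub_le z s (k + 1) (n - (k + 1))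
  rw [show k + 1 + (n - (k + 1)) = n by omega, h, path_succ] at hrest
  rw [abs_le] at hstart hrest
  cases hs : s k <;> simp only [hs, step_true, step_false] at hrest <;>
    exact ⟨by omega, by first | rfl | omega⟩

/-- The site `y` is recognized, among those at distance less than `D`, by the run of `H` ones
that starts there. -/
structure IsBeacon (e : ℤ → Bool) (y : ℤ) (D H : ℕ) : Prop where
  run : ∀ z ∈ Finset.Ico y (y + H), e z = true
  exists_right_false : ∀ p ≠ y, |p - y| < D → ∃ z ∈ Finset.Ico p (p + H), e z = false
  exists_left_true : ∀ p, |p - y| < D → ∃ z ∈ Finset.Ico (p - H) p, e z = true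

theorem IsBeacon.congr {e e' : ℤ → Bool} {y : ℤ} {D H : ℕ}
    (he : ∀ z ∈ Set.Icc (y - D - H) (y + D + H), e z = e' z) (h : IsBeacon e y D H) :
    IsBeacon e' y D H := by
  have hrestrict {a b : ℤ} {c : Bool} (ha : y - D - H ≤ a) (hb : b ≤ y + D + H) :
      ∀ z ∈ Finset.Ico a b, e z = c → e' z = c := by
    intro z hz hez
    rw [Finset.mem_Ico] at hz
    rw [← he z ⟨by omega, by omega⟩, hez]
  refine ⟨fun z hz => hrestrict (by omega) (by omega) z hz (h.run z hz), fun p hp hpy => ?_,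
    fun p hpy => ?_⟩
  · obtain ⟨z, hz, hf⟩ := h.exists_right_false p hp hpy
    rw [abs_lt] at hpy
    exact ⟨z, hz, hrestrict (by omega) (by omega) z hz hf⟩
  · obtain ⟨z, hz, ht⟩ := h.exists_left_true p hpy
    rw [abs_lt] at hpy
    exact ⟨z, hz, hrestrict (by omega) (by omega) z hz ht⟩

theorem eq_of_crossing_eq_true {e : ℤ → Bool} {p : ℤ} {s : ℕ → Bool} {H : ℕ}
    (h : ∀ i < H, crossing e (path p s i) (s i) = true) : ∀ i < H, s i = s 0 := by
  intro i hi
  induction i with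
  | zero => rfl
  | succ i ih =>
    rw [← ih (by omega)]
    by_contra hne
    have hturn := h (i + 1) hi
    rw [path_succ, Bool.eq_not.2 hne, crossing_reverse, h i (by omega)] at hturn
    exact Bool.false_ne_true hturn

theorem IsBeacon.eq_of_crossing_eq_true {e : ℤ → Bool} {y p : ℤ} {D H : ℕ} {s : ℕ → Bool}
    (hB : IsBeacon e y D H) (hp : |p - y| < D)
    (h : ∀ i < H, crossing e (path p s i) (s i) = true) : p = y := by
  have hs := SceneryReconstruction.eq_of_crossing_eq_true h
  have hpath (i : ℕ) (hi : i < H) : crossing e (p + i * step (s 0)) (s 0) = true := by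
    rw [← path_eq_of_const p fun k hk => hs k (hk.trans hi), ← hs i hi]
    exact h i hi
  cases h0 : s 0 with
  | true =>
    by_contra hne
    obtain ⟨z, hz, hf⟩ := hB.exists_right_false p hne hp
    rw [Finset.mem_Ico] at hz
    have hcross := hpath (z - p).toNat (by omega)
    rw [h0, step_true, show p + ((z - p).toNat : ℤ) * 1 = z by omega, crossing, if_pos rfl,
      hf] at hcross
    exact Bool.false_ne_true hcross
  | false =>
    obtain ⟨z, hz, ht⟩ := hB.exists_left_true p hp
    rw [Finset.mem_Ico] at hz
    have hcross := hpath (p - 1 - z).toNat (by omega)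
    rw [h0, step_false, show p + ((p - 1 - z).toNat : ℤ) * -1 = z + 1 by omega, crossing,
      if_neg Bool.false_ne_true, add_sub_cancel_right, ht] at hcross
    exact absurd hcross Bool.false_ne_true

section Escape

variable {e' e : ℤ → Bool} {x yl yr : ℤ} {D H n₀ n₁ : ℕ}

/-- The walk runs straight from the left end of the beacon `yl` to the right end of the beacon
`yr`. A follower that is close in the end is close at both beacons, hence in step with the walk at
both, hence in step in between; but then it disagrees with the walk at the edge `x`. -/
theorem far_of_straight_walk (hl : IsBeacon e yl D H) (hr : IsBeacon e yr D H)
    (hl' : IsBeacon e' yl D H) (hr' : IsBeacon e' yr D H) (hx : e' x ≠ e x) (hlx : yl ≤ x)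
    (hxr : x < yr) (hn₁ : (n₁ : ℤ) = yr + H - yl) {p : ℤ} {σ : ℕ → Bool}
    (hσ : ∀ i < n₁, crossing e' (path p σ i) (σ i) = e (yl + i))
    (hp : |p - yl| < D ∨ 2 * n₁ + D < |p - yl|) : D ≤ |path p σ n₁ - (yl + n₁)| := by
  by_contra! hlt
  have hclose : |p - yl| < D := by
    refine hp.resolve_right fun hc => ?_
    have := abs_path_sub_le p σ n₁
    rw [abs_le] at this
    rw [abs_lt] at hlt
    rw [lt_abs] at hc
    omega
  obtain rfl : p = yl := hl'.eq_of_crossing_eq_true hclose fun i hi => by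
    rw [hσ i (by omega)]
    exact hl.run _ (Finset.mem_Ico.2 ⟨by omega, by omega⟩)
  obtain ⟨m, hm⟩ : ∃ m : ℕ, (m : ℤ) = yr - p := ⟨(yr - p).toNat, by omega⟩
  have hn₁m : n₁ = m + H := by omega
  have hmeet : path p σ m = yr := by
    refine hr'.eq_of_crossing_eq_true (s := shift m σ) ?_ fun i hi => ?_
    · have hbefore := abs_path_sub_le p σ m
      have hafter := abs_path_add_sub_le p σ m H
      rw [← hn₁m] at hafter
      rw [abs_le] at hbefore hafter
      rw [abs_lt] at hlt ⊢
      omega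
    · rw [← path_add]
      refine (hσ (m + i) (by omega)).trans ?_
      rw [← hr.run (yr + i) (Finset.mem_Ico.2 ⟨by omega, by omega⟩)]
      congr 1
      push_cast
      omega
  obtain ⟨k, hk⟩ : ∃ k : ℕ, (k : ℤ) = x - p := ⟨(x - p).toNat, by omega⟩
  obtain ⟨hpk, hσk⟩ := eq_true_of_path_eq_add (show path p σ m = p + m by omega)
    (show k < m by omega)
  have hcross := hσ k (by omega)
  rw [hpk, hσk, show p + (k : ℤ) = x by omega] at hcross
  exact hx hcross

theorem exists_forall_not_hasFollower (h : fairCoins ℕ (farFollowed e' e yl D) < 1) (R : ℤ) :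
    ∃ s n, ∀ q, D ≤ |q - yl| → |q - yl| ≤ R → ¬HasFollower e' e yl s q n := by
  obtain ⟨s, hs⟩ : ∃ s, s ∉ farFollowed e' e yl D := by
    by_contra! hc
    rw [Set.eq_univ_of_forall hc, measure_univ] at h
    exact lt_irrefl _ h
  refine ⟨s, ?_⟩
  by_contra! hc
  obtain ⟨q, hq, hf⟩ := exists_mem_forall_of_antitone
    (F := (Finset.Icc (yl - R) (yl + R)).filter fun q => (D : ℤ) ≤ |q - yl|)
    (p := fun q n => HasFollower e' e yl s q n) (fun _ _ _ hnm h => h.mono hnm) fun n => by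
      obtain ⟨q, hD, hR, hf⟩ := hc n
      have := abs_le.1 hR
      exact ⟨q, Finset.mem_filter.2 ⟨Finset.mem_Icc.2 ⟨by omega, by omega⟩, hD⟩, hf⟩
  exact hs ⟨q, (Finset.mem_filter.1 hq).2, hf⟩

theorem path_reverse_then_straight {s₀ s : ℕ → Bool} {y : ℤ}
    (hrev : ∀ i < n₀, s i = reverse s₀ n₀ i) {i : ℕ} (hstr : ∀ j < i, s (n₀ + j) = true) :
    path (path y s₀ n₀) s (n₀ + i) = y + i := by
  rw [path_add, path_congr _ hrev, path_reverse y s₀ le_rfl, Nat.sub_self, path_zero,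
    path_eq_of_const y (s := shift n₀ s) hstr, step_true, mul_one]

/-- Retracing `s₀` backwards to `yl` disposes of the followers at medium distance from `yl`, since
reversing them would give followers of `s₀`. -/
theorem far_of_reverse_then_straight (hl : IsBeacon e yl D H) (hr : IsBeacon e yr D H)
    (hl' : IsBeacon e' yl D H) (hr' : IsBeacon e' yr D H) (hx : e' x ≠ e x) (hlx : yl ≤ x)
    (hxr : x < yr) (hn₁ : (n₁ : ℤ) = yr + H - yl) {s₀ s τ : ℕ → Bool} {q : ℤ}
    (hs₀ : ∀ q, D ≤ |q - yl| → |q - yl| ≤ 2 * n₁ + D → ¬HasFollower e' e yl s₀ q n₀)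
    (hrev : ∀ i < n₀, s i = reverse s₀ n₀ i) (hstr : ∀ i < n₁, s (n₀ + i) = true)
    (hτ : ∀ i < n₀ + n₁, crossing e' (path q τ i) (τ i)
      = crossing e (path (path yl s₀ n₀) s i) (s i)) :
    D ≤ |path q τ (n₀ + n₁) - (yr + H)| := by
  have hpath (i : ℕ) (hi : i ≤ n₁) : path (path yl s₀ n₀) s (n₀ + i) = yl + i :=
    path_reverse_then_straight hrev fun j hj => hstr j (hj.trans_le hi)
  have hback : HasFollower e' e yl s₀ (path q τ n₀) n₀ := by
    have h := hasFollower_reverse (n := n₀) fun i hi => hτ i (by omega)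
    rw [show path (path yl s₀ n₀) s n₀ = yl by simpa using hpath 0 n₁.zero_le] at h
    refine h.congr fun i hi => ?_
    rw [reverse, hrev _ (by omega), reverse, Bool.not_not]
    congr 1
    omega
  have hfar : |path q τ n₀ - yl| < D ∨ 2 * n₁ + D < |path q τ n₀ - yl| := by
    by_contra! hc
    exact hs₀ _ hc.1 hc.2 hback
  have hcross (i : ℕ) (hi : i < n₁) :
      crossing e' (path (path q τ n₀) (shift n₀ τ) i) (shift n₀ τ i) = e (yl + i) := by
    rw [← path_add]
    refine (hτ (n₀ + i) (by omega)).trans ?_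
    rw [hpath i hi.le, hstr i hi]
    rfl
  have h := far_of_straight_walk hl hr hl' hr' hx hlx hxr hn₁ hcross hfar
  rwa [← path_add, show yl + (n₁ : ℤ) = yr + H by omega] at h

theorem measurableSet_farFollowed (e' e : ℤ → Bool) (b : ℤ) (D : ℕ) :
    MeasurableSet (farFollowed e' e b D) := by
  simp only [farFollowed, Set.ofPred_exists, Set.ofPred_and, Set.ofPred_forall]
  exact MeasurableSet.iUnion fun q => (MeasurableSet.const _).inter
    (MeasurableSet.iInter fun n => measurableSet_hasFollower e' e b q n)

theorem shift_mem_farFollowed {z₀ z₁ q : ℤ} {W s : ℕ → Bool} {N : ℕ} (hend : path z₀ W N = z₁)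
    (hW : ∀ q τ, (∀ i < N, crossing e' (path q τ i) (τ i) = crossing e (path z₀ W i) (W i)) →
      D ≤ |path q τ N - z₁|)
    (hs : ∀ i < N, s i = W i) (hq : ∀ n, HasFollower e' e z₀ s q n) :
    shift N s ∈ farFollowed e' e z₁ D := by
  have hpath (i : ℕ) (hi : i ≤ N) : path z₀ s i = path z₀ W i :=
    path_congr z₀ fun k hk => hs k (hk.trans_le hi)
  obtain ⟨q', hq', hf⟩ := exists_mem_forall_of_antitone
    (F := (Finset.Icc (q - N) (q + N)).filter fun q' => (D : ℤ) ≤ |q' - z₁|)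
    (p := fun q' n => HasFollower e' e z₁ (shift N s) q' n) (fun _ _ _ hnm h => h.mono hnm)
    fun n => by
      obtain ⟨τ, hτ⟩ := hq (N + n)
      have hD := hW q τ fun i hi => by rw [hτ i (by omega), hpath i hi.le, hs i hi]
      have hdist := abs_le.1 (abs_path_sub_le q τ N)
      refine ⟨path q τ N, Finset.mem_filter.2 ⟨Finset.mem_Icc.2 ⟨by omega, by omega⟩, hD⟩,
        shift N τ, fun i hi => ?_⟩
      rw [← hend, ← hpath N le_rfl, ← path_add, ← path_add]
      exact hτ (N + i) (by omega)
  exact ⟨q', (Finset.mem_filter.1 hq').2, hf⟩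

theorem fairCoins_exists_hasFollower_lt_one {z₀ z₁ : ℤ} {W : ℕ → Bool} {N : ℕ}
    (hgood : fairCoins ℕ (farFollowed e' e z₁ D) < 1) (hend : path z₀ W N = z₁)
    (hW : ∀ q τ, (∀ i < N, crossing e' (path q τ i) (τ i) = crossing e (path z₀ W i) (W i)) →
      D ≤ |path q τ N - z₁|) :
    fairCoins ℕ {s | ∃ q, ∀ n, HasFollower e' e z₀ s q n} < 1 := by
  let P : Set (ℕ → Bool) := {s | ∀ i ∈ Finset.range N, s i = W i}
  have hP : DependsOn (fun s => s ∈ P) (Set.Iio N) :=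
    (dependsOn_cylinder (Finset.range N) W).mono (by simp)
  have hPm : MeasurableSet P := measurableSet_of_dependsOn_finite (Set.finite_Iio N) hP
  have hPpos : fairCoins ℕ P ≠ 0 := by
    rw [fairCoins_cylinder (Finset.range N) W]
    simp
  have hsub : {s | ∃ q, ∀ n, HasFollower e' e z₀ s q n}
      ⊆ Pᶜ ∪ (P ∩ shift N ⁻¹' farFollowed e' e z₁ D) := by
    rintro s ⟨q, hq⟩
    refine (em (s ∈ P)).elim (fun hs => Or.inr ⟨hs, ?_⟩) Or.inl
    exact shift_mem_farFollowed hend hW (fun i hi => hs i (Finset.mem_range.2 hi)) hq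
  calc _ ≤ fairCoins ℕ Pᶜ + fairCoins ℕ (P ∩ shift N ⁻¹' farFollowed e' e z₁ D) :=
        (measure_mono hsub).trans (measure_union_le _ _)
    _ = fairCoins ℕ Pᶜ + fairCoins ℕ P * fairCoins ℕ (farFollowed e' e z₁ D) := by
        rw [fairCoins_inter_preimage_shift hP (measurableSet_farFollowed e' e z₁ D)]
    _ < fairCoins ℕ Pᶜ + fairCoins ℕ P * 1 := by
        refine ENNReal.add_lt_add_left (by finiteness) ?_
        exact ENNReal.mul_lt_mul_right hPpos (by finiteness) hgood
    _ = 1 := by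
        rw [mul_one, add_comm]
        exact prob_add_prob_compl hPm

theorem exists_fairCoins_exists_hasFollower_lt_one (hl : IsBeacon e yl D H)
    (hr : IsBeacon e yr D H) (hl' : IsBeacon e' yl D H) (hr' : IsBeacon e' yr D H)
    (hx : e' x ≠ e x) (hlx : yl ≤ x) (hxr : x < yr)
    (gl : fairCoins ℕ (farFollowed e' e yl D) < 1)
    (gr : fairCoins ℕ (farFollowed e' e (yr + H) D) < 1) :
    ∃ z₀, fairCoins ℕ {s | ∃ q, ∀ n, HasFollower e' e z₀ s q n} < 1 := by
  obtain ⟨n₁, hn₁⟩ : ∃ n : ℕ, (n : ℤ) = yr + H - yl := ⟨(yr + H - yl).toNat, by omega⟩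
  obtain ⟨s₀, n₀, hs₀⟩ := exists_forall_not_hasFollower gl (2 * n₁ + D)
  let W (i : ℕ) : Bool := if i < n₀ then reverse s₀ n₀ i else true
  have hrev : ∀ i < n₀, W i = reverse s₀ n₀ i := fun i hi => if_pos hi
  have hstr : ∀ i < n₁, W (n₀ + i) = true := fun i _ => if_neg (by omega)
  have hend : path (path yl s₀ n₀) W (n₀ + n₁) = yr + H := by
    rw [path_reverse_then_straight hrev hstr]
    omega
  exact ⟨path yl s₀ n₀, fairCoins_exists_hasFollower_lt_one gr hend fun q τ hτ =>
    far_of_reverse_then_straight hl hr hl' hr' hx hlx hxr hn₁ hs₀ hrev hstr hτ⟩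

end Escape

/-! ### Existence of beacons -/

theorem fairCoins_real_cylinder {κ : Type*} (I : Finset κ) (v : κ → Bool) :
    (fairCoins κ).real {ω | ∀ i ∈ I, ω i = v i} = (1 / 2) ^ I.card := by
  rw [measureReal_def, fairCoins_cylinder]
  simp

theorem fairCoins_real_cylinder_inter_le {κ : Type*} {I₁ I₂ : Finset κ} {v₁ v₂ : κ → Bool}
    (h : Disjoint I₁ I₂ ∨ ∃ i, i ∈ I₁ ∧ i ∈ I₂ ∧ v₁ i ≠ v₂ i) :
    (fairCoins κ).real ({ω | ∀ i ∈ I₁, ω i = v₁ i} ∩ {ω | ∀ i ∈ I₂, ω i = v₂ i})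
      ≤ (1 / 2) ^ (I₁.card + I₂.card) := by
  rcases h with hdisj | ⟨i, h₁, h₂, hne⟩
  · rw [measureReal_def, fairCoins_cylinder_inter v₁ (measurableSet_cylinder_eq I₂ v₂)
      ((dependsOn_cylinder I₂ v₂).mono
        (Set.subset_compl_iff_disjoint_left.2 (Finset.disjoint_coe.2 hdisj))),
      ENNReal.toReal_mul, ← measureReal_def, fairCoins_real_cylinder, pow_add]
    simp
  · have hempty : {ω : κ → Bool | ∀ i ∈ I₁, ω i = v₁ i} ∩ {ω | ∀ i ∈ I₂, ω i = v₂ i} = ∅ :=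
      Set.eq_empty_of_forall_notMem fun ω hω => hne ((hω.1 i h₁).symm.trans (hω.2 i h₂))
    rw [hempty, measureReal_empty]
    positivity

theorem dependsOn_not_isBeacon (y : ℤ) (D H : ℕ) :
    DependsOn (fun e => e ∈ {e | ¬IsBeacon e y D H}) (Set.Icc (y - D - H) (y + D + H)) :=
  dependsOn_mem_of_imp fun _ _ h hb hb' => hb (hb'.congr fun z hz => (h z hz).symm)

theorem measurableSet_not_isBeacon (y : ℤ) (D H : ℕ) : MeasurableSet {e | ¬IsBeacon e y D H} :=
  measurableSet_of_dependsOn_finite (Set.finite_Icc _ _) (dependsOn_not_isBeacon y D H)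

/-- The environments with a run of exactly `H` ones that starts at `y`. -/
def isolatedRun (y : ℤ) (H : ℕ) : Set (ℤ → Bool) :=
  {e | ∀ z ∈ Finset.Icc (y - 1) (y + H), e z = decide (z ∈ Finset.Ico y (y + H))}

/-- The environments with value `b` throughout the `H` edges from `p` on. -/
def constantRun (b : Bool) (p : ℤ) (H : ℕ) : Set (ℤ → Bool) :=
  {e | ∀ z ∈ Finset.Ico p (p + H), e z = b}

theorem isolatedRun_subset (y : ℤ) (D H : ℕ) :
    isolatedRun y H ⊆ {e | IsBeacon e y D H} ∪
      ((⋃ p ∈ (Finset.Icc (y - D) (y + D)).erase y, isolatedRun y H ∩ constantRun true p H) ∪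
        ⋃ p ∈ Finset.Icc (y - D) (y + D), isolatedRun y H ∩ constantRun false (p - H) H) := by
  intro e he
  refine or_iff_not_imp_right.2 fun hc => ?_
  simp only [constantRun, Set.mem_union, Set.mem_iUnion, not_or, not_exists, Set.mem_inter_iff,
    Set.mem_ofPred_eq, not_and, not_forall, Bool.not_eq_true, Bool.not_eq_false, sub_add_cancel,
    exists_prop] at hc
  refine ⟨fun z hz => ?_, fun p hp hpy => ?_, fun p hpy => ?_⟩
  · have hz' := Finset.mem_Ico.1 hz
    rw [he z (Finset.mem_Icc.2 ⟨by omega, by omega⟩), decide_eq_true hz]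
  · rw [abs_lt] at hpy
    exact hc.1 p (Finset.mem_erase.2 ⟨hp, Finset.mem_Icc.2 ⟨by omega, by omega⟩⟩) he
  · rw [abs_lt] at hpy
    exact hc.2 p (Finset.mem_Icc.2 ⟨by omega, by omega⟩) he

theorem fairCoins_real_isolatedRun (y : ℤ) (H : ℕ) :
    (fairCoins ℤ).real (isolatedRun y H) = (1 / 2) ^ (H + 2) := by
  rw [isolatedRun, fairCoins_real_cylinder (Finset.Icc (y - 1) (y + H))
    fun z => decide (z ∈ Finset.Ico y (y + H)), Int.card_Icc]
  congr 1
  omega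

theorem fairCoins_real_isolatedRun_inter_true_le {y p : ℤ} {H : ℕ} (hp : p ≠ y) :
    (fairCoins ℤ).real (isolatedRun y H ∩ constantRun true p H) ≤ (1 / 2) ^ (2 * H + 2) := by
  refine (fairCoins_real_cylinder_inter_le (v₂ := fun _ => true) ?_).trans_eq ?_
  · by_cases hleft : p ≤ y - 1 ∧ y - 1 < p + H
    · exact Or.inr ⟨y - 1, by simp; omega, by simp; omega, by simp⟩
    · by_cases hright : p ≤ y + H ∧ y + H < p + H
      · exact Or.inr ⟨y + H, by simp; omega, by simp; omega, by simp⟩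
      · refine Or.inl (Finset.disjoint_left.2 fun z hz hz' => ?_)
        rw [Finset.mem_Icc] at hz
        rw [Finset.mem_Ico] at hz'
        omega
  · rw [Int.card_Icc, Int.card_Ico]
    congr 1
    omega

theorem fairCoins_real_isolatedRun_inter_false_le (y p : ℤ) (H : ℕ) :
    (fairCoins ℤ).real (isolatedRun y H ∩ constantRun false p H) ≤ (1 / 2) ^ (2 * H) := by
  have hsub : isolatedRun y H ⊆ constantRun true y H := fun e he z hz => by
    have hz' := Finset.mem_Ico.1 hz
    rw [he z (Finset.mem_Icc.2 ⟨by omega, by omega⟩), decide_eq_true hz]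
  refine (measureReal_mono (Set.inter_subset_inter_left _ hsub)).trans
    ((fairCoins_real_cylinder_inter_le (v₁ := fun _ => true) (v₂ := fun _ => false) ?_).trans_eq ?_)
  · refine or_iff_not_imp_left.2 fun h => ?_
    obtain ⟨z, hz, hz'⟩ := Finset.not_disjoint_iff.1 h
    exact ⟨z, hz, hz', Bool.false_ne_true.symm⟩
  · rw [Int.card_Ico, Int.card_Ico]
    congr 1
    omega

theorem fairCoins_real_not_isBeacon_le (y : ℤ) {D H : ℕ} (hD : 1 ≤ D) (hH : 32 * D ≤ 2 ^ H) :
    (fairCoins ℤ).real {e | ¬IsBeacon e y D H} ≤ 1 - (1 / 2) ^ (H + 3) := by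
  have hcard : (Finset.Icc (y - D) (y + D)).card = 2 * D + 1 := by
    rw [Int.card_Icc]
    omega
  have hcard' : ((Finset.Icc (y - D) (y + D)).erase y).card = 2 * D := by
    rw [Finset.card_erase_of_mem (Finset.mem_Icc.2 ⟨by omega, by omega⟩), hcard]
    rfl
  have htrue := (measureReal_biUnion_finset_le (μ := fairCoins ℤ) _ _).trans
    (Finset.sum_le_card_nsmul ((Finset.Icc (y - D) (y + D)).erase y) _ _ fun p hp =>
      fairCoins_real_isolatedRun_inter_true_le (H := H) (Finset.ne_of_mem_erase hp))
  have hfalse := (measureReal_biUnion_finset_le (μ := fairCoins ℤ) _ _).trans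
    (Finset.sum_le_card_nsmul (Finset.Icc (y - D) (y + D)) _ _ fun p _ =>
      fairCoins_real_isolatedRun_inter_false_le y (p - H) H)
  have hunion := (measureReal_mono (μ := fairCoins ℤ) (isolatedRun_subset y D H)).trans
    ((measureReal_union_le _ _).trans (add_le_add_right (measureReal_union_le _ _) _))
  have hcompl : (fairCoins ℤ).real {e | IsBeacon e y D H}
      = 1 - (fairCoins ℤ).real {e | ¬IsBeacon e y D H} := by
    rw [← probReal_compl_eq_one_sub (measurableSet_not_isBeacon y D H)]
    simp only [Set.compl_ofPred, not_not]
  rw [hcard', nsmul_eq_mul, pow_add, two_mul H, pow_add] at htrue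
  rw [hcard, nsmul_eq_mul, two_mul H, pow_add] at hfalse
  rw [fairCoins_real_isolatedRun, hcompl, pow_add] at hunion
  rw [pow_add]
  have hpow : (32 * D : ℝ) ≤ 2 ^ H := by exact_mod_cast hH
  have hsmall : 32 * (D * (1 / 2 : ℝ) ^ H) ≤ 1 := by
    rw [one_div_pow, mul_one_div, ← mul_div_assoc]
    exact div_le_one_of_le₀ hpow (by positivity)
  have hD' : (1 : ℝ) ≤ D := by exact_mod_cast hD
  have ht : (0 : ℝ) < (1 / 2) ^ H := by positivity
  generalize ((1 : ℝ) / 2) ^ H = t at *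
  push_cast at htrue hfalse
  nlinarith [mul_le_mul_of_nonneg_right hsmall ht.le,
    mul_nonneg (sub_nonneg.2 hD') (mul_pos ht ht).le]

/-- The `i`-th candidate for a beacon at the right (`c = 1`) or left (`c = -1`) of `[-K, K]`. The
windows that decide whether candidates are beacons are disjoint from each other and from
`[-K, K]`. -/
def candidate (K c : ℤ) (D H i : ℕ) : ℤ := c * (K + (2 * (D + H) + 1) * (i + 1))

theorem add_lt_candidate (K : ℤ) (D H i : ℕ) : K + D + H < candidate K 1 D H i := by
  have : (2 * ((D : ℤ) + H) + 1) * 1 ≤ (2 * (D + H) + 1) * (i + 1) := by gcongr; omega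
  rw [candidate]
  omega

theorem candidate_neg_one (K : ℤ) (D H i : ℕ) : candidate K (-1) D H i = -candidate K 1 D H i := by
  rw [candidate, candidate, one_mul, neg_one_mul]

theorem disjoint_Icc_candidate (K : ℤ) {c : ℤ} (hc : c = 1 ∨ c = -1) (D H : ℕ) {i j : ℕ}
    (hij : i < j) :
    Disjoint (Set.Icc (candidate K c D H i - D - H) (candidate K c D H i + D + H))
      (Set.Icc (candidate K c D H j - D - H) (candidate K c D H j + D + H)) := by
  have hgap : (2 * ((D : ℤ) + H) + 1) * (i + 1) + (2 * (D + H) + 1)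
      ≤ (2 * (D + H) + 1) * (j + 1) := by
    rw [← mul_add_one]
    gcongr
    omega
  refine Set.disjoint_left.2 fun z hz hz' => ?_
  rw [Set.mem_Icc, candidate] at hz hz'
  rcases hc with rfl | rfl <;> omega

theorem fairCoins_real_forall_not_isBeacon_le (K : ℤ) {c : ℤ} (hc : c = 1 ∨ c = -1) {D H : ℕ}
    (hD : 1 ≤ D) (hH : 32 * D ≤ 2 ^ H) (n : ℕ) :
    (fairCoins ℤ).real {e | ∀ i < n, ¬IsBeacon e (candidate K c D H i) D H}
      ≤ (1 - (1 / 2) ^ (H + 3)) ^ n := by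
  have hdep (n : ℕ) : DependsOn
      (fun e => e ∈ {e | ∀ i < n, ¬IsBeacon e (candidate K c D H i) D H})
      (⋃ i ∈ Set.Iio n,
        Set.Icc (candidate K c D H i - D - H) (candidate K c D H i + D + H)) :=
    dependsOn_mem_of_imp fun e e' h he i hi hb => he i hi <| hb.congr fun z hz =>
      (h z (Set.mem_biUnion (Set.mem_Iio.2 hi) hz)).symm
  induction n with
  | zero => simp
  | succ n ih =>
    have hset : {e | ∀ i < n + 1, ¬IsBeacon e (candidate K c D H i) D H}
        = {e | ¬IsBeacon e (candidate K c D H n) D H}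
          ∩ {e | ∀ i < n, ¬IsBeacon e (candidate K c D H i) D H} := by
      ext e
      exact Nat.forall_lt_succ_right.trans and_comm
    have hmeas := measurableSet_of_dependsOn_finite
      ((Set.finite_Iio n).biUnion fun _ _ => Set.finite_Icc _ _) (hdep n)
    have hindep := infinitePi_inter_of_dependsOn
      (μ := fun _ : ℤ => bernoulliMeasure true false oneHalf)
      (Set.disjoint_iUnion₂_right.2 fun i hi => (disjoint_Icc_candidate K hc D H hi).symm)
      (measurableSet_not_isBeacon _ D H) hmeas (dependsOn_not_isBeacon _ D H) (hdep n)
    rw [hset, measureReal_def, fairCoins, hindep, ENNReal.toReal_mul, pow_succ']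
    have hone := fairCoins_real_not_isBeacon_le (candidate K c D H n) hD hH
    exact mul_le_mul hone ih measureReal_nonneg (measureReal_nonneg.trans hone)

theorem exists_two_pow_between {D : ℕ} (hD : 1 ≤ D) : ∃ H, 32 * D ≤ 2 ^ H ∧ 2 ^ H ≤ 64 * D := by
  refine ⟨Nat.log 2 (32 * D) + 1, (Nat.lt_pow_succ_log_self (by omega) _).le, ?_⟩
  have := Nat.pow_log_le_self 2 (x := 32 * D) (by omega)
  rw [pow_succ]
  omega

theorem fairCoins_real_forall_not_isBeacon_le_exp (K : ℤ) {c : ℤ} (hc : c = 1 ∨ c = -1) {D H : ℕ}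
    (hD : 1 ≤ D) (hH : 32 * D ≤ 2 ^ H) (hH' : 2 ^ H ≤ 64 * D) :
    (fairCoins ℤ).real {e | ∀ i < D ^ 2, ¬IsBeacon e (candidate K c D H i) D H}
      ≤ Real.exp (-(D / 512)) := by
  have hD' : (0 : ℝ) < D := by exact_mod_cast hD
  have hpow : (2 : ℝ) ^ H ≤ 64 * D := by exact_mod_cast hH'
  have hrate : 1 / (512 * D : ℝ) ≤ (1 / 2) ^ (H + 3) := by
    rw [one_div_pow]
    refine one_div_le_one_div_of_le (by positivity) ?_
    rw [pow_add]
    linarith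
  have hle : ((1 : ℝ) / 2) ^ (H + 3) ≤ 1 := pow_le_one₀ (by norm_num) (by norm_num)
  calc _ ≤ (1 - (1 / 2 : ℝ) ^ (H + 3)) ^ (D ^ 2) :=
        fairCoins_real_forall_not_isBeacon_le K hc hD hH _
    _ ≤ Real.exp (-(1 / (512 * D))) ^ (D ^ 2) := by
        refine pow_le_pow_left₀ (by linarith) ?_ _
        linarith [Real.add_one_le_exp (-(1 / (512 * D : ℝ)))]
    _ = Real.exp (-(D / 512)) := by
        rw [← Real.exp_nat_mul]
        congr 1
        push_cast
        field_simp

section Mask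

variable {m : ℤ → Bool} {K : ℤ}

theorem exists_escape_of_candidates (hm : ∀ z, m z = true → |z| ≤ K) {x : ℤ} (hx : m x = true)
    {e : ℤ → Bool} {J H i j : ℕ}
    (hl : IsBeacon e (candidate K (-1) (farRadius J) H i) (farRadius J) H)
    (hr : IsBeacon e (candidate K 1 (farRadius J) H j) (farRadius J) H)
    (gl : IsGoodSite m J (candidate K (-1) (farRadius J) H i) e)
    (gr : IsGoodSite m J (candidate K 1 (farRadius J) H j + H) e) :
    ∃ z₀, fairCoins ℕ {s | ∃ q, ∀ n, HasFollower (twist m e) e z₀ s q n} < 1 := by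
  have hxK := abs_le.1 (hm x hx)
  have hli := add_lt_candidate K (farRadius J) H i
  have hrj := add_lt_candidate K (farRadius J) H j
  rw [candidate_neg_one] at hl gl
  have htwist (z : ℤ) (hz : K < |z|) : e z = twist m e z := by
    rw [twist, Bool.eq_false_of_not_eq_true fun h => hz.not_ge (hm z h), Bool.xor_false]
  refine exists_fairCoins_exists_hasFollower_lt_one hl hr (hl.congr fun z hz => ?_)
    (hr.congr fun z hz => ?_) (x := x) (by simp [twist, hx]) (by omega) (by omega) gl gr
  · exact htwist z (lt_abs.2 (Or.inr (by have := hz.2; omega)))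
  · exact htwist z (lt_abs.2 (Or.inl (by have := hz.1; omega)))

theorem farRadius_sq (J : ℕ) : farRadius J ^ 2 = 4 * J ^ 14 := by
  rw [farRadius]
  ring

theorem fairCoins_exists_not_isGoodSite_le {J : ℕ} (hJ : 1 ≤ J) {ε : ℝ≥0∞}
    (hε : ∀ b, (J : ℝ≥0∞) ^ 14 * fairCoins ℤ {e | ¬IsGoodSite m J b e} ≤ ε) (b : ℕ → ℤ) :
    fairCoins ℤ (⋃ i ∈ Finset.range (farRadius J ^ 2), {e | ¬IsGoodSite m J (b i) e})
      ≤ 4 * ε := by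
  have hJ0 : (J : ℝ≥0∞) ^ 14 ≠ 0 := pow_ne_zero _ (Nat.cast_ne_zero.2 (by omega))
  calc _ ≤ ∑ i ∈ Finset.range (farRadius J ^ 2), fairCoins ℤ {e | ¬IsGoodSite m J (b i) e} :=
        measure_biUnion_finset_le _ _
    _ ≤ ∑ i ∈ Finset.range (farRadius J ^ 2), ε / (J : ℝ≥0∞) ^ 14 :=
        Finset.sum_le_sum fun i _ => by
          rw [ENNReal.le_div_iff_mul_le (Or.inl hJ0) (Or.inl (by finiteness)), mul_comm]
          exact hε (b i)
    _ = 4 * ε := by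
        rw [Finset.sum_const, nsmul_eq_mul, Finset.card_range, farRadius_sq]
        push_cast
        rw [mul_assoc, ENNReal.mul_div_cancel hJ0 (by finiteness)]

theorem fairCoins_not_escape_le (hm : ∀ z, m z = true → |z| ≤ K) {x : ℤ} (hx : m x = true) {J : ℕ}
    (hJ : 1 ≤ J) {ε : ℝ≥0∞}
    (hε : ∀ b, (J : ℝ≥0∞) ^ 14 * fairCoins ℤ {e | ¬IsGoodSite m J b e} ≤ ε) :
    fairCoins ℤ {e | ¬∃ z₀, fairCoins ℕ {s | ∃ q, ∀ n, HasFollower (twist m e) e z₀ s q n} < 1}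
      ≤ 2 * ENNReal.ofReal (Real.exp (-(J / 512))) + 8 * ε := by
  have hJD : J ≤ farRadius J := by
    have := Nat.le_self_pow (n := 7) (by norm_num) J
    rw [farRadius]
    omega
  obtain ⟨H, hH, hH'⟩ := exists_two_pow_between (hJ.trans hJD)
  let noBeacon (c : ℤ) : Set (ℤ → Bool) :=
    {e | ∀ i < farRadius J ^ 2,
      ¬IsBeacon e (candidate K c (farRadius J) H i) (farRadius J) H}
  let badSite (b : ℕ → ℤ) : Set (ℤ → Bool) :=
    ⋃ i ∈ Finset.range (farRadius J ^ 2), {e | ¬IsGoodSite m J (b i) e}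
  have hsub : {e | ¬∃ z₀, fairCoins ℕ {s | ∃ q, ∀ n, HasFollower (twist m e) e z₀ s q n} < 1}
      ⊆ (noBeacon (-1) ∪ noBeacon 1) ∪ (badSite (candidate K (-1) (farRadius J) H)
        ∪ badSite fun i => candidate K 1 (farRadius J) H i + H) := by
    intro e he
    by_contra hc
    simp only [noBeacon, badSite, Set.mem_union, not_or, Set.mem_ofPred_eq, Set.mem_iUnion,
      not_exists, not_forall, not_not, exists_prop, Finset.mem_range, not_and] at hc
    obtain ⟨⟨⟨i, hi, hl⟩, j, hj, hr⟩, gl, gr⟩ := hc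
    exact he (exists_escape_of_candidates hm hx hl hr (gl i hi) (gr j hj))
  have hbeacon (c : ℤ) (hc : c = 1 ∨ c = -1) :
      fairCoins ℤ (noBeacon c) ≤ ENNReal.ofReal (Real.exp (-(J / 512))) := by
    rw [← ofReal_measureReal]
    refine ENNReal.ofReal_le_ofReal ((fairCoins_real_forall_not_isBeacon_le_exp K hc
      (hJ.trans hJD) hH hH').trans (Real.exp_le_exp.2 ?_))
    have : (J : ℝ) ≤ farRadius J := by exact_mod_cast hJD
    linarith
  have hsite := fairCoins_exists_not_isGoodSite_le hJ hε
  calc _ ≤ _ := measure_mono hsub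
    _ ≤ _ := (measure_union_le _ _).trans
        (add_le_add (measure_union_le _ _) (measure_union_le _ _))
    _ ≤ _ := add_le_add (add_le_add (hbeacon _ (Or.inr rfl)) (hbeacon _ (Or.inl rfl)))
        (add_le_add (hsite _) (hsite _))
    _ = _ := by ring

theorem ae_exists_escape (hm : ∀ z, m z = true → |z| ≤ K) {x : ℤ} (hx : m x = true) :
    ∀ᵐ e ∂fairCoins ℤ,
      ∃ z₀, fairCoins ℕ {s | ∃ q, ∀ n, HasFollower (twist m e) e z₀ s q n} < 1 := by
  obtain ⟨ε, hε, hgood⟩ := exists_tendsto_pow_mul_not_isGoodSite_le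
  have hexp : Filter.Tendsto (fun J : ℕ => ENNReal.ofReal (Real.exp (-((J : ℝ) / 512))))
      Filter.atTop (nhds 0) := by
    rw [← ENNReal.ofReal_zero]
    exact ENNReal.tendsto_ofReal (Real.tendsto_exp_neg_atTop_nhds_zero.comp
      (tendsto_natCast_atTop_atTop.atTop_div_const (by norm_num)))
  have hlim := (ENNReal.Tendsto.const_mul (a := 2) hexp (Or.inr (by simp))).add
    (ENNReal.Tendsto.const_mul (a := 8) hε (Or.inr (by simp)))
  rw [mul_zero, mul_zero, add_zero] at hlim
  rw [ae_iff]
  refine le_antisymm (ge_of_tendsto hlim ?_) bot_le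
  filter_upwards [Filter.eventually_ge_atTop 1] with J hJ
  exact fairCoins_not_escape_le hm hx hJ fun b => hgood m J b hJ

end Mask

/-! ### From colors to edges -/

/-- The environment of a scenery. The bit of the edge `{z, z + 1}` tells whether its end points have
the same color, negated at odd `z`: this makes the bits independent and fair, and since the walker
knows the parity of its position, the symbols it reads off the bits carry the same information as
the color record. -/
def edgeBits (ξ : Scenery) : ℤ → Bool :=
  fun z => xor (decide (ξ z = ξ (z + 1))) (decide (z % 2 = 1))

theorem crossing_edgeBits (ξ : Scenery) (z : ℤ) (b : Bool) :
    crossing (edgeBits ξ) z b = xor (decide (ξ z = ξ (z + step b))) (decide (z % 2 = 1)) := by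
  cases b
  · have hparity : decide ((z - 1) % 2 = 1) = !decide (z % 2 = 1) := by
      rw [← decide_not, decide_eq_decide]
      omega
    have hsymm : decide (ξ (z - 1) = ξ z) = decide (ξ z = ξ (z - 1)) :=
      decide_eq_decide.2 eq_comm
    simp [crossing, edgeBits, hparity, hsymm, ← sub_eq_add_neg]
  · rfl

theorem measurable_edgeBits : Measurable edgeBits := by
  refine measurable_pi_lambda _ fun z => ?_
  have hcolors : Measurable fun ξ : Scenery => (ξ z, ξ (z + 1)) :=
    (measurable_pi_apply z).prodMk (measurable_pi_apply (z + 1))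
  exact (measurable_of_finite fun c : Fin 2 × Fin 2 =>
    xor (decide (c.1 = c.2)) (decide (z % 2 = 1))).comp hcolors

/-- The scenery with the colors exchanged to the right of `i`. -/
def swapRight (i : ℤ) (ξ : Scenery) : Scenery := fun z => if i < z then 1 - ξ z else ξ z

theorem measurable_swapRight (i : ℤ) : Measurable (swapRight i) :=
  measurable_pi_lambda _ fun z =>
    (measurable_of_finite fun c : Fin 2 => if i < z then 1 - c else c).comp (measurable_pi_apply z)

theorem sceneryMeasure_map_swapRight (i : ℤ) :
    sceneryMeasure.map (swapRight i) = sceneryMeasure := by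
  have hmap := Measure.infinitePi_map_pi (fun _ : ℤ => bernoulliMeasure (1 : Fin 2) 0 oneHalf)
    (f := fun z c => if i < z then 1 - c else c) fun _ => measurable_of_finite _
  refine hmap.trans (congrArg Measure.infinitePi (funext fun z => ?_))
  rw [bernoulliMeasure_oneHalf_map _ _ (measurable_of_finite _)]
  split_ifs
  · exact bernoulliMeasure_oneHalf_comm _ _
  · rfl

theorem edgeBits_swapRight (i : ℤ) (ξ : Scenery) :
    edgeBits (swapRight i ξ) = Function.update (edgeBits ξ) i (!edgeBits ξ i) := by
  have hswap : ∀ a b : Fin 2, decide (a = 1 - b) = !decide (a = b) := by decide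
  funext z
  rcases lt_trichotomy z i with hz | rfl | hz
  · simp [edgeBits, swapRight, hz.not_gt, hz.ne, show ¬i < z + 1 by omega]
  · simp [edgeBits, swapRight, hswap]
  · simp [edgeBits, swapRight, hz, hz.ne', show i < z + 1 by omega]

theorem sceneryMeasure_map_edgeBits : sceneryMeasure.map edgeBits = fairCoins ℤ := by
  have : IsProbabilityMeasure (sceneryMeasure.map edgeBits) :=
    Measure.isProbabilityMeasure_map measurable_edgeBits.aemeasurable
  refine eq_fairCoins_of_map_update_not fun i => ?_
  rw [Measure.map_map (by fun_prop) measurable_edgeBits]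
  conv_rhs => rw [← sceneryMeasure_map_swapRight i,
    Measure.map_map measurable_edgeBits (measurable_swapRight i)]
  exact congrArg sceneryMeasure.map (funext fun ξ => (edgeBits_swapRight i ξ).symm)

theorem exists_edgeBits_eq_twist {ξ η : Scenery} (hfin : {x | η x ≠ ξ x}.Finite)
    (hne : {x | η x ≠ ξ x}.Nonempty) :
    ∃ F : Finset ℤ, F.Nonempty ∧ edgeBits η = twist (fun z => decide (z ∈ F)) (edgeBits ξ) := by
  have hedges : {z | edgeBits η z ≠ edgeBits ξ z}.Finite := by
    refine (hfin.union (hfin.preimage (add_left_injective (1 : ℤ)).injOn)).subset fun z hz => ?_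
    by_contra hc
    simp only [Set.mem_union, Set.mem_preimage, Set.mem_ofPred_eq, not_or, not_not] at hc
    exact hz (by rw [edgeBits, edgeBits, hc.1, hc.2])
  refine ⟨hedges.toFinset, ?_, ?_⟩
  · obtain ⟨x, hx, hmax⟩ := hfin.exists_maximal hne
    have hsucc : η (x + 1) = ξ (x + 1) := by
      by_contra hc
      have := hmax hc (by omega)
      omega
    have hchange : ∀ a b c : Fin 2, a ≠ b → ¬(a = c ↔ b = c) := by decide
    refine ⟨x, hedges.mem_toFinset.2 ?_⟩
    simpa [edgeBits, hsucc] using hchange _ _ _ hx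
  · funext z
    rw [twist, ← Bool.xor_comm]
    cases h : edgeBits η z <;> cases h' : edgeBits ξ z <;> simp [h, h']

/-! ### Testing a color record -/

theorem measurable_path_zero : Measurable (path 0) :=
  measurable_pi_lambda _ fun n => measurable_path 0 n

theorem simpleRandomWalk_eq_map_path : simpleRandomWalk = (fairCoins ℕ).map (path 0) := by
  have hstep : Measurable fun (s : ℕ → Bool) i => step (s i) :=
    measurable_pi_lambda _ fun i => (measurable_of_finite step).comp (measurable_pi_apply i)
  have hlaw : stepMeasure = (fairCoins ℕ).map fun s i => step (s i) := by
    rw [fairCoins, Measure.infinitePi_map_pi _ fun _ => measurable_of_finite step]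
    simp only [bernoulliMeasure_oneHalf_map _ _ (measurable_of_finite step)]
    rfl
  rw [simpleRandomWalk, hlaw, Measure.map_map measurable_walk hstep]
  congr 1
  funext s n
  rw [path, zero_add]
  rfl

theorem path_emod_two (z : ℤ) (s : ℕ → Bool) (n : ℕ) : path z s n % 2 = (z + n) % 2 := by
  induction n with
  | zero => simp
  | succ n ih =>
    rw [path_succ]
    push_cast
    rcases step_eq_or (s n) with h | h <;> omega

/-- The color records all of whose finite initial parts can be seen along some nearest-neighbor path
that starts at the origin of `η`. -/
def possibleRecords (η : Scenery) : Set (ℕ → Fin 2) :=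
  {X | ∀ n, ∃ τ : ℕ → Bool, ∀ i < n, X i = η (path 0 τ i)}

theorem measurableSet_possibleRecords (η : Scenery) : MeasurableSet (possibleRecords η) := by
  simp only [possibleRecords, Set.ofPred_forall]
  refine MeasurableSet.iInter fun n => measurableSet_of_dependsOn_finite (Set.finite_Iio n)
    (dependsOn_mem_of_imp fun X X' h => ?_)
  rintro ⟨τ, hτ⟩
  exact ⟨τ, fun i hi => (h i hi).symm.trans (hτ i hi)⟩

theorem hasFollower_of_mem_possibleRecords {ξ η : Scenery} {s : ℕ → Bool}
    (h : colorRecord ξ (path 0 s) ∈ possibleRecords η) (n : ℕ) :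
    HasFollower (edgeBits η) (edgeBits ξ) 0 s 0 n := by
  obtain ⟨τ, hτ⟩ := h (n + 1)
  refine ⟨τ, fun i hi => ?_⟩
  have hnow : ξ (path 0 s i) = η (path 0 τ i) := hτ i (by omega)
  have hnext : ξ (path 0 s (i + 1)) = η (path 0 τ (i + 1)) := hτ (i + 1) (by omega)
  rw [crossing_edgeBits, crossing_edgeBits, ← path_succ, ← path_succ, hnow, hnext, path_emod_two,
    path_emod_two]

theorem measurable_colorRecord (ξ : Scenery) : Measurable (colorRecord ξ) :=
  measurable_pi_lambda _ fun k => (measurable_of_countable ξ).comp (measurable_pi_apply k)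

theorem distinguishable_of_escape {ξ η : Scenery} {z₀ : ℤ}
    (h : fairCoins ℕ {s | ∃ q, ∀ n, HasFollower (edgeBits η) (edgeBits ξ) z₀ s q n} < 1) :
    Distinguishable ξ η := by
  have hmeas := measurableSet_possibleRecords η
  refine ⟨(possibleRecords η)ᶜ, hmeas.compl, ?_, ?_⟩
  · rw [simpleRandomWalk_eq_map_path, ae_map_iff measurable_path_zero.aemeasurable
      (measurable_colorRecord ξ hmeas.compl), ae_iff]
    exact measure_mono_null (fun s hs n => hasFollower_of_mem_possibleRecords (not_not.1 hs) n)
      (fairCoins_forall_hasFollower_eq_zero h 0 0)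
  · rw [simpleRandomWalk_eq_map_path]
    exact (ae_map_iff measurable_path_zero.aemeasurable
      (measurable_colorRecord η hmeas.compl).compl).2
      (Filter.Eventually.of_forall fun s hs => hs fun n => ⟨s, fun i _ => rfl⟩)

theorem ae_forall_exists_escape : ∀ᵐ ξ ∂sceneryMeasure, ∀ F : Finset ℤ, F.Nonempty → ∃ z₀,
    fairCoins ℕ {s | ∃ q, ∀ n,
      HasFollower (twist (fun z => decide (z ∈ F)) (edgeBits ξ)) (edgeBits ξ) z₀ s q n} < 1 := by
  refine ae_all_iff.2 fun F => ?_
  by_cases hF : F.Nonempty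
  · obtain ⟨x, hx⟩ := hF
    obtain ⟨K, hK⟩ := (F.image abs).exists_le
    have hescape := ae_exists_escape (m := fun z => decide (z ∈ F)) (K := K)
      (fun z hz => hK _ (Finset.mem_image_of_mem _ (of_decide_eq_true hz))) (decide_eq_true hx)
    rw [← sceneryMeasure_map_edgeBits] at hescape
    exact (ae_of_ae_map measurable_edgeBits.aemeasurable hescape).mono fun _ h _ => h
  · exact Filter.Eventually.of_forall fun _ h => absurd h hF

theorem corollary2_general :
    ∃ 𝕊 : Set Scenery, MeasurableSet 𝕊 ∧ sceneryMeasure 𝕊 = 1 ∧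
      ∀ ξ ∈ 𝕊, ∀ η : Scenery, {x | η x ≠ ξ x}.Finite → {x | η x ≠ ξ x}.Nonempty →
        Distinguishable ξ η := by
  obtain ⟨N, hsub, hN, hN0⟩ :=
    exists_measurable_superset_of_null (ae_iff.1 ae_forall_exists_escape)
  refine ⟨Nᶜ, hN.compl, (prob_compl_eq_one_iff hN).2 hN0, fun ξ hξ η hfin hne => ?_⟩
  obtain ⟨F, hF, htwist⟩ := exists_edgeBits_eq_twist hfin hne
  obtain ⟨z₀, hz₀⟩ := not_not.1 (fun hc => hξ (hsub hc)) F hF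
  exact distinguishable_of_escape (htwist ▸ hz₀)

end SceneryReconstruction

theorem corollary2 :
    ∃ 𝕊 : Set SceneryReconstruction.Scenery,
      MeasurableSet 𝕊 ∧ SceneryReconstruction.sceneryMeasure 𝕊 = 1 ∧
        ∀ ξ ∈ 𝕊, ∀ η : SceneryReconstruction.Scenery,
          SceneryReconstruction.DifferInOnePoint ξ η →
            SceneryReconstruction.Distinguishable ξ η := by
  obtain ⟨𝕊, hmeas, hone, hdist⟩ := SceneryReconstruction.corollary2_general
  exact ⟨𝕊, hmeas, hone, fun ξ hξ η ⟨x, hx, huniq⟩ =>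
    hdist ξ hξ η ((Set.finite_singleton x).subset huniq) ⟨x, hx⟩⟩
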